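/- **Setting.** Let $G=\mathrm{PSL}(2,\mathbb R)$ and let $a_t,b_s,c_u,d_\pi\in G$ be the classes of $\begin{pmatrix}e^{t/2}&0\\0&e^{-t/2}\end{pmatrix}$, $\begin{pmatrix}1&s\\0&1\end{pmatrix}$, $\begin{pmatrix}1&0\\u&1\end{pmatrix}$, $\begin{pmatrix}0&1\\-1&0\end{pmatrix}$. Let $d_G$ be the distance on $G$ of the left-invariant Riemannian metric given at the identity by $\langle A,B\rangle=\operatorname{tr}(A^{T}B)$. Let $\Gamma\le G$ be a discrete subgroup such that $X=\Gamma\backslash G$ is compact, with the flow $\varphi_t(\Gamma g)=\Gamma g a_t$, the time reversal $\mathcal T(\Gamma g)=\Gamma g d_\pi$ and the distance $d_X(\Gamma g_1,\Gamma g_2)=\inf_{\gamma_1,\gamma_2\in\Gamma}d_G(\gamma_1g_1,\gamma_2g_2)$. Write $z=(u,s)_x$ if $x=\Gamma g$ and $z=\Gamma g c_ub_s$ for some $g\in G$, and $\mathcal P_\varepsilon(x)=\{(u,s)_x:|u|,|s|<\varepsilon\}$. A $T$-periodic orbit is the orbit of a point $x$ with $\varphi_T(x)=x$, $T>0$ ($T$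 need not be the minimal period). A $T$-periodic orbit $c$ and a $T'$-periodic orbit $c'$ form a $\delta$-orbit pair ($c'$ is a $\delta$-partner of $c$) if there are $L\ge2$, decompositions $0=t_0<\dots<t_L=T$ and $0=t'_0<\dots<t'_L=T'$, a permutation $\sigma$ of $\{0,\dots,L-1\}$ and points $x_0\in c$, $x_0'\in c'$ such that for each $j$ either $d_X(\varphi_{t+t_j}(x_0),\varphi_{t+t'_{\sigma(j)}}(x_0'))<\delta$ for all $t\in[0,t_{j+1}-t_j]$, or $d_X(\varphi_{t+t_j}(x_0),\varphi_{t-t'_{\sigma(j)+1}}(\mathcal T(x_0')))<\delta$ for all these $t$. **Constants.** There exists $\sigma_0>0$ such that (i) $d_G(\gamma g,g)>\sigma_0$ for all $\gamma\in\Gamma\setminus\{e\}$, $g\in G$. There exists $\varepsilon_*>0$ such that (ii) whenever $0<\varepsilon<\varepsilon_*$ and $x_1,x_2\in X$ have periods $T_1,T_2>0$ with $|T_1-T_2|\le\sqrt2\,\varepsilon$ and $d_X(\varphi_t(x_1),\varphi_t(x_2))<\varepsilon$ for all $t\in[0,\min\{T_1,T_2\}]$, then $T_1=T_2$ and the orbits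 of $x_1,x_2$ coincide. In what follows $\sigma_0$ is any constant with (i). **Theorem (two 2-parallel encounters, intertwined).** Let $0<\varepsilon<\sigma_0/20$ and let $c$ be a $T$-periodic orbit of $(\varphi_t)$ with two $(2,\varepsilon)$-parallel encounters intertwined: there are $x,y,z,w\in c$ and $T_1,T_2,T_3,T_4>0$ with $T_1+T_2+T_3+T_4=T$, $\varphi_{T_1}(x)=y$, $\varphi_{T_2}(y)=z$, $\varphi_{T_3}(z)=w$, $\varphi_{T_4}(w)=x$, and $z=(u_1,s_1)_x\in\mathcal P_\varepsilon(x)$, $w=(u_2,s_2)_y\in\mathcal P_\varepsilon(y)$, where $|u_i|,|s_i|<\varepsilon$. Assume $$|u_2|>9\varepsilon e^{-T_4},\qquad |s_2|>72\varepsilon^3+5\varepsilon e^{-T_1}+2\varepsilon e^{-T_3}.$$ Then $c$ has a $19\varepsilon$-partner orbit $c'$, with period $T'$, which differs in both encounters, in the following sense. * It runs through the stretches of $c$ in the order $x\to y$, $w\to x$, $z\to w$, $y\to z$ (the connections are switched in both encounters): there is $v\in c'$ such that $d_X(\varphi_t(v),\varphi_t(x))<19\varepsilon$ for $t\in[0,T_1]$,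 $d_X(\varphi_{T_1+t}(v),\varphi_t(w))<19\varepsilon$ for $t\in[0,T_4]$, $d_X(\varphi_{T_1+T_4+t}(v),\varphi_t(z))<19\varepsilon$ for $t\in[0,T_3]$, and $d_X(\varphi_{T_1+T_4+T_3+t}(v),\varphi_t(y))<19\varepsilon$ for $t\in[0,\max\{T_2,\,T'-(T_1+T_4+T_3)\}]$. * It passes through a point of $\mathcal P_{5\varepsilon}(y)$ different from $y$ and $w$ (so $c'\neq c$ whenever $c$ meets $\mathcal P_{5\varepsilon}(y)$ only in $y$ and $w$). The action difference satisfies $$\Big|\frac{T'-T}{2}-\ln\big((1+u_1s_1)(1+u_2s_2)\big)\Big|\le 54\varepsilon^4+25\varepsilon^2\big(e^{-T_1}+e^{-T_2}+e^{-T_3}+e^{-T_4}\big).$$ If moreover $\varepsilon<\varepsilon_*/38$ for some constant $\varepsilon_*$ with (ii), the partner is unique: any two periodic orbits, with periods $T'$ and $T''$, which run through the stretches of $c$ in the switched order within $19\varepsilon$ as in the first item (with $T'$ replaced by $T''$ for the second one) and whose periods satisfy the displayed estimate, coincide, and $T'=T''$. -/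

import Mathlib

open Set

noncomputable section

namespace HadamardGutzwiller

/-- The group `PSL(2, ℝ) = SL(2, ℝ) / {± 1}`, with its quotient topology. -/
abbrev PSL2R : Type := Matrix.ProjectiveSpecialLinearGroup (Fin 2) ℝ

/-- The class in `PSL(2, ℝ)` of a matrix of determinant one. -/
def toPSL (A : Matrix.SpecialLinearGroup (Fin 2) ℝ) : PSL2R := QuotientGroup.mk A

/-- `a_t`, the class of `diag(e^{t/2}, e^{-t/2})`. -/
def a (t : ℝ) : PSL2R :=
  toPSL ⟨!![Real.exp (t / 2), 0; 0, Real.exp (-t / 2)], by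
    rw [Matrix.det_fin_two_of, ← Real.exp_add]
    ring_nf
    simp⟩

/-- `b_s`, the class of the upper unipotent matrix with entry `s`. -/
def b (s : ℝ) : PSL2R :=
  toPSL ⟨!![1, s; 0, 1], by simp [Matrix.det_fin_two_of]⟩

/-- `c_u`, the class of the lower unipotent matrix with entry `u`. -/
def c (u : ℝ) : PSL2R :=
  toPSL ⟨!![1, 0; u, 1], by simp [Matrix.det_fin_two_of]⟩

/-- `d_π`, the class of `(0 1; -1 0)`. -/
def dPi : PSL2R :=
  toPSL ⟨!![0, 1; -1, 0], by simp [Matrix.det_fin_two_of]⟩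

/-- The length on `[0, 1]` of a curve in `SL(2, ℝ)` for the left-invariant Riemannian metric which
is the Frobenius inner product `⟨X, Y⟩ = tr (Xᵀ Y)` on the Lie algebra: the integral of the
Frobenius norm of `A⁻¹ A'`. -/
def curveLength (A : ℝ → Matrix.SpecialLinearGroup (Fin 2) ℝ) : ℝ :=
  ∫ t in (0 : ℝ)..1, Real.sqrt (∑ i, ∑ j,
    ((((A t)⁻¹ : Matrix.SpecialLinearGroup (Fin 2) ℝ) : Matrix (Fin 2) (Fin 2) ℝ) *
      Matrix.of (fun k l => deriv (fun r => (A r : Matrix (Fin 2) (Fin 2) ℝ) k l) t)) i j ^ 2)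

/-- The Riemannian distance on `PSL(2, ℝ)`: the infimum of the lengths of `C¹` curves from `g` to
`h`. The curves are described by their lifts to the double cover `SL(2, ℝ)`; both lifts of the
end point are allowed. With this normalization `t ↦ a_t` has constant speed `1 / √2` and
`b`, `c` have unit speed. -/
def dG (g h : PSL2R) : ℝ :=
  sInf {r : ℝ | ∃ A : ℝ → Matrix.SpecialLinearGroup (Fin 2) ℝ,
    (∀ i j, ContDiff ℝ 1 (fun t => (A t : Matrix (Fin 2) (Fin 2) ℝ) i j)) ∧
    toPSL (A 0) = g ∧ toPSL (A 1) = h ∧ r = curveLength A}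

/-- `X = Γ \ PSL(2, ℝ)`, the space of right cosets `Γ g`, with the quotient topology. -/
abbrev PhaseSpace (Γ : Subgroup PSL2R) : Type := Quotient (QuotientGroup.rightRel Γ)

/-- The point `Γ g` of `X`. -/
def pt (Γ : Subgroup PSL2R) (g : PSL2R) : PhaseSpace Γ :=
  Quotient.mk (QuotientGroup.rightRel Γ) g

/-- Right translation `Γ g ↦ Γ g h` on `X`. -/
def rightTranslate (Γ : Subgroup PSL2R) (h : PSL2R) : PhaseSpace Γ → PhaseSpace Γ :=
  Quotient.map (fun g => g * h) (by
    intro g₁ g₂ hg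
    have h1 : g₂ * g₁⁻¹ ∈ Γ := QuotientGroup.rightRel_apply.mp hg
    refine QuotientGroup.rightRel_apply.mpr ?_
    have h2 : g₂ * h * (g₁ * h)⁻¹ = g₂ * g₁⁻¹ := by group
    rw [h2]
    exact h1)

/-- The flow `φ_t (Γ g) = Γ g a_t`. -/
def flow (Γ : Subgroup PSL2R) (t : ℝ) : PhaseSpace Γ → PhaseSpace Γ := rightTranslate Γ (a t)

/-- The time reversal map `Γ g ↦ Γ g d_π`. -/
def timeReversal (Γ : Subgroup PSL2R) : PhaseSpace Γ → PhaseSpace Γ := rightTranslate Γ dPi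

/-- The distance on `X`: the infimum of `dG g₁ g₂` over all representatives. -/
def dX (Γ : Subgroup PSL2R) (x₁ x₂ : PhaseSpace Γ) : ℝ :=
  sInf {r : ℝ | ∃ g₁ g₂ : PSL2R, pt Γ g₁ = x₁ ∧ pt Γ g₂ = x₂ ∧ r = dG g₁ g₂}

/-- `z = (u, s)_x`, i.e. `z = Γ g c_u b_s` where `x = Γ g`. -/
def HasCoords (Γ : Subgroup PSL2R) (x z : PhaseSpace Γ) (u s : ℝ) : Prop :=
  ∃ g : PSL2R, x = pt Γ g ∧ z = pt Γ (g * c u * b s)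

/-- The Poincaré section of radius `ε` at `x`. -/
def poincareSection (Γ : Subgroup PSL2R) (ε : ℝ) (x : PhaseSpace Γ) : Set (PhaseSpace Γ) :=
  {z | ∃ u s : ℝ, |u| < ε ∧ |s| < ε ∧ HasCoords Γ x z u s}

/-- The orbit of `x` under the flow. -/
def orbit (Γ : Subgroup PSL2R) (x : PhaseSpace Γ) : Set (PhaseSpace Γ) :=
  range (fun t => flow Γ t x)

/-- `O` is a periodic orbit having `T > 0` as a (not necessarily minimal) period. -/
def IsPeriodicOrbit (Γ : Subgroup PSL2R) (T : ℝ) (O : Set (PhaseSpace Γ)) : Prop :=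
  0 < T ∧ ∃ x, flow Γ T x = x ∧ O = orbit Γ x

/-- The `T`-periodic orbit `O` and the `T'`-periodic orbit `O'` form a `δ`-orbit pair
(`O'` is a `δ`-partner orbit of `O`). -/
def IsOrbitPair (Γ : Subgroup PSL2R) (δ : ℝ) (O : Set (PhaseSpace Γ)) (T : ℝ)
    (O' : Set (PhaseSpace Γ)) (T' : ℝ) : Prop :=
  ∃ L : ℕ, 2 ≤ L ∧ ∃ t t' : Fin (L + 1) → ℝ,
    StrictMono t ∧ t 0 = 0 ∧ t (Fin.last L) = T ∧
    StrictMono t' ∧ t' 0 = 0 ∧ t' (Fin.last L) = T' ∧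
    ∃ σ : Equiv.Perm (Fin L), ∃ x ∈ O, ∃ x' ∈ O', ∀ j : Fin L,
      (∀ r ∈ Icc 0 (t j.succ - t j.castSucc),
        dX Γ (flow Γ (r + t j.castSucc) x) (flow Γ (r + t' (σ j).castSucc) x') < δ) ∨
      (∀ r ∈ Icc 0 (t j.succ - t j.castSucc),
        dX Γ (flow Γ (r + t j.castSucc) x)
          (flow Γ (r - t' (σ j).succ) (timeReversal Γ x')) < δ)

/-- An orbit through `x`, `y`, `z`, `w` runs cyclically through the four stretches
`x → y` (duration `T₁`), `y → z` (`T₂`), `z → w` (`T₃`), `w → x` (`T₄`); there is one encounter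
near `x`, `z` and one near `y`, `w`. Switching the connections in both encounters gives the cyclic
order `x → y`, `w → x`, `z → w`, `y → z`. The orbit `O'` with period `T'` follows this reconnected
sequence of stretches within distance `δ`, for the whole time `[0, max (T, T')]` where
`T = T₁ + T₂ + T₃ + T₄`, if it has a point `v` as below. -/
def FollowsReconnected (Γ : Subgroup PSL2R) (δ : ℝ) (x y z w : PhaseSpace Γ)
    (T₁ T₂ T₃ T₄ : ℝ) (O' : Set (PhaseSpace Γ)) (T' : ℝ) : Prop :=
  ∃ v ∈ O',
    (∀ t ∈ Icc 0 T₁, dX Γ (flow Γ t v) (flow Γ t x) < δ) ∧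
    (∀ t ∈ Icc 0 T₄, dX Γ (flow Γ (T₁ + t) v) (flow Γ t w) < δ) ∧
    (∀ t ∈ Icc 0 T₃, dX Γ (flow Γ (T₁ + T₄ + t) v) (flow Γ t z) < δ) ∧
    (∀ t ∈ Icc 0 (max T₂ (T' - (T₁ + T₄ + T₃))),
      dX Γ (flow Γ (T₁ + T₄ + T₃ + t) v) (flow Γ t y) < δ)

/-- `σ₀ > 0` bounds from below all displacements by nontrivial elements of `Γ`. -/
def IsDisplacementConst (Γ : Subgroup PSL2R) (σ₀ : ℝ) : Prop :=
  0 < σ₀ ∧ ∀ γ ∈ Γ, γ ≠ 1 → ∀ g : PSL2R, σ₀ < dG (γ * g) g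

/-- `εs > 0` is a constant such that for every `0 < ε < εs`, two periodic points whose periods
differ by at most `√2 ε` and which stay `ε`-close during the smaller period have the same period
and the same orbit. -/
def IsCoincidenceConst (Γ : Subgroup PSL2R) (εs : ℝ) : Prop :=
  0 < εs ∧ ∀ ε : ℝ, 0 < ε → ε < εs → ∀ (x₁ x₂ : PhaseSpace Γ) (T₁ T₂ : ℝ), 0 < T₁ → 0 < T₂ →
    flow Γ T₁ x₁ = x₁ → flow Γ T₂ x₂ = x₂ → |T₁ - T₂| ≤ Real.sqrt 2 * ε →
    (∀ t ∈ Icc 0 (min T₁ T₂), dX Γ (flow Γ t x₁) (flow Γ t x₂) < ε) →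
    T₁ = T₂ ∧ orbit Γ x₁ = orbit Γ x₂

end HadamardGutzwiller

end

open HadamardGutzwiller

/-!
The group `G` acts on `X = Γ \ G` from the right, and the hypotheses say `z = x · c_{u₁} b_{s₁}`
and `w = y · c_{u₂} b_{s₂}`. Put `Cᵢ = c_{uᵢ} b_{sᵢ}`. Walking along the stretches of the old
orbit in the switched order and stepping across the encounters by `Cᵢ` or `Cᵢ⁻¹` leads from `x`
back to `x`, so `x · M = x` for `M = a_{T₁} C₂ a_{T₄} C₁ a_{T₃} C₂⁻¹ a_{T₂} C₁⁻¹`. Each `Cᵢ` is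
close to the identity and the factors `a_T` expand, so `M` has an expanding direction `(1, m₀)`
and a contracting direction `(r₀, 1)` with `m₀`, `r₀` of order `ε`; both are fixed points of maps
of an interval into itself (`exists_expanding_slopes`, `exists_contracting_ratios`). With `k` the
matrix spanned by these directions, `M k = k a_{T'}`, hence `v = x · k` is `T'`-periodic.

The position of the new orbit relative to the old one is recorded by `HasFrame`, whose three
numbers (scaling factor, expanding and contracting displacement) change in an explicit way along
the flow (`HasFrame.conj`) and across a connection (`HasFrame.conn_inv_mul`, `HasFrame.conn_mul`).
They bound the distance of the orbits (`HasFrame.dX_flow_lt`), and the scaling factor gives the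
period: the two inverse connections stretch the expanding direction by `1 + uᵢ sᵢ`, the other two
do not stretch it, up to errors of size `ε² e^{-Tⱼ}`, since all slopes at the beginning of a
stretch `j` are of size `ε e^{-Tⱼ}`. This is `exists_reconnected_point`.

For the metric one needs the triangle inequality for `dG`, where curves are joined with a smooth
reparametrization that stops at the junction (`exists_concat`), and the converse fact that short
curves stay near their origin (`abs_entry_sub_le`). The latter, with discreteness of `Γ` and
compactness of `X`, gives the displacement constant `σ₀`. The coincidence constant may be taken to
be `σ₀ / 4`: two orbits closer than this have lifts translated by the same `γ ∈ Γ`, so `a_T` and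
`a_T'` are conjugate. Uniqueness of the partner is an application of any coincidence constant, two
partners being within `38 ε` of each other.
-/

open HadamardGutzwiller

namespace HadamardGutzwiller

/-! ### Curves in `SL(2, ℝ)` and their speed -/

/-- The double cover of `PSL(2, ℝ)` in which curves are described. -/
abbrev SL2 : Type := Matrix.SpecialLinearGroup (Fin 2) ℝ

/-- A curve in `SL(2, ℝ)` is `C¹` if its matrix entries are. -/
def IsC1 (A : ℝ → SL2) : Prop :=
  ∀ i j, ContDiff ℝ 1 (fun t => (A t : Matrix (Fin 2) (Fin 2) ℝ) i j)

/-- The entrywise derivative of a curve of matrices. -/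
noncomputable def velocity (A : ℝ → SL2) (t : ℝ) : Matrix (Fin 2) (Fin 2) ℝ :=
  Matrix.of fun k l => deriv (fun r => (A r : Matrix (Fin 2) (Fin 2) ℝ) k l) t

/-- The Riemannian speed of a curve, i.e. the Frobenius norm of `A⁻¹ A'`. -/
noncomputable def speed (A : ℝ → SL2) (t : ℝ) : ℝ :=
  Real.sqrt (∑ i, ∑ j, ((((A t)⁻¹ : SL2) : Matrix (Fin 2) (Fin 2) ℝ) * velocity A t) i j ^ 2)

theorem curveLength_eq (A : ℝ → SL2) : curveLength A = ∫ t in (0 : ℝ)..1, speed A t := rfl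

theorem speed_nonneg (A : ℝ → SL2) (t : ℝ) : 0 ≤ speed A t := Real.sqrt_nonneg _

theorem curveLength_nonneg (A : ℝ → SL2) : 0 ≤ curveLength A :=
  intervalIntegral.integral_nonneg (by norm_num) fun t _ => speed_nonneg A t

theorem isC1_const (P : SL2) : IsC1 (fun _ => P) := fun _ _ => contDiff_const

theorem IsC1.mul {A B : ℝ → SL2} (hA : IsC1 A) (hB : IsC1 B) : IsC1 (fun t => A t * B t) := by
  intro i j
  simp only [Matrix.SpecialLinearGroup.coe_mul, Matrix.mul_apply]
  exact ContDiff.sum fun k _ => (hA i k).mul (hB k j)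

theorem IsC1.comp {A : ℝ → SL2} (hA : IsC1 A) {ψ : ℝ → ℝ} (hψ : ContDiff ℝ 1 ψ) :
    IsC1 (fun t => A (ψ t)) := fun i j => (hA i j).comp hψ

theorem IsC1.differentiableAt {A : ℝ → SL2} (hA : IsC1 A) (i j : Fin 2) (t : ℝ) :
    DifferentiableAt ℝ (fun t => (A t : Matrix (Fin 2) (Fin 2) ℝ) i j) t :=
  (hA i j).differentiable (by norm_num) t

theorem velocity_const (P : SL2) (t : ℝ) : velocity (fun _ => P) t = 0 := by
  ext i j
  simp [velocity]

theorem velocity_mul {A B : ℝ → SL2} (hA : IsC1 A) (hB : IsC1 B) (t : ℝ) :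
    velocity (fun t => A t * B t) t =
      velocity A t * (B t : Matrix (Fin 2) (Fin 2) ℝ) +
        (A t : Matrix (Fin 2) (Fin 2) ℝ) * velocity B t := by
  ext i j
  simp only [velocity, Matrix.of_apply, Matrix.add_apply, Matrix.mul_apply,
    Matrix.SpecialLinearGroup.coe_mul, Fin.sum_univ_two]
  have h := (((hA.differentiableAt i 0 t).hasDerivAt.mul (hB.differentiableAt 0 j t).hasDerivAt).add
    ((hA.differentiableAt i 1 t).hasDerivAt.mul (hB.differentiableAt 1 j t).hasDerivAt)).deriv
  refine Eq.trans ?_ (h.trans ?_)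
  · rfl
  · ring

theorem velocity_comp {A : ℝ → SL2} (hA : IsC1 A) {ψ : ℝ → ℝ} {ψ' t : ℝ} (hψ : HasDerivAt ψ ψ' t) :
    velocity (fun t => A (ψ t)) t = ψ' • velocity A (ψ t) := by
  ext i j
  simp only [velocity, Matrix.of_apply, Matrix.smul_apply, smul_eq_mul]
  have h := ((hA.differentiableAt i j (ψ t)).hasDerivAt.comp t hψ).deriv
  rw [mul_comm] at h
  exact h

theorem speed_congr {A B : ℝ → SL2} {t t' : ℝ} (h : A t = B t')
    (h' : velocity A t = velocity B t') :
    speed A t = speed B t' := by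
  rw [speed, speed, h, h']

theorem speed_comp {A : ℝ → SL2} (hA : IsC1 A) {ψ : ℝ → ℝ} {ψ' t : ℝ} (hψ : HasDerivAt ψ ψ' t) :
    speed (fun t => A (ψ t)) t = |ψ'| * speed A (ψ t) := by
  rw [speed, velocity_comp hA hψ, speed, ← Real.sqrt_sq_eq_abs, ← Real.sqrt_mul (sq_nonneg _)]
  congr 1
  simp only [Matrix.mul_smul, Matrix.smul_apply, smul_eq_mul, Fin.sum_univ_two]
  ring

theorem speed_const_mul {A : ℝ → SL2} (hA : IsC1 A) (P : SL2) (t : ℝ) :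
    speed (fun t => P * A t) t = speed A t := by
  rw [speed, velocity_mul (isC1_const P) hA, velocity_const, speed]
  congr 1
  simp only [Matrix.zero_mul, zero_add, mul_inv_rev, ← Matrix.mul_assoc,
    ← Matrix.SpecialLinearGroup.coe_mul, inv_mul_cancel_right]

theorem curveLength_const_mul {A : ℝ → SL2} (hA : IsC1 A) (P : SL2) :
    curveLength (fun t => P * A t) = curveLength A := by
  rw [curveLength_eq, curveLength_eq]
  exact intervalIntegral.integral_congr fun t _ => speed_const_mul hA P t

theorem IsC1.continuous_speed {A : ℝ → SL2} (hA : IsC1 A) : Continuous (speed A) := by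
  have h : ∀ i j, Continuous fun t => velocity A t i j := fun i j =>
    (hA i j).continuous_deriv le_rfl
  have h' : ∀ i j, Continuous fun t => (A t : Matrix (Fin 2) (Fin 2) ℝ) i j := fun i j =>
    (hA i j).continuous
  unfold speed
  refine Real.continuous_sqrt.comp (continuous_finsetSum _ fun i _ =>
    continuous_finsetSum _ fun j _ => ?_)
  simp only [Matrix.SpecialLinearGroup.coe_inv, Matrix.adjugate_fin_two, Matrix.mul_apply,
    Fin.sum_univ_two]
  fin_cases i <;> fin_cases j <;>
    simp only [Matrix.of_apply, Matrix.cons_val', Matrix.cons_val_zero, Matrix.cons_val_one,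
      Fin.zero_eta, Fin.mk_one, Matrix.cons_val_fin_one] <;>
    fun_prop

/-- Reversal of a curve. -/
theorem curveLength_reverse {A : ℝ → SL2} (hA : IsC1 A) :
    curveLength (fun t => A (1 - t)) = curveLength A := by
  rw [curveLength_eq, curveLength_eq]
  have h : ∀ t : ℝ, speed (fun t => A (1 - t)) t = speed A (1 - t) := fun t => by
    rw [speed_comp hA (ψ := fun t => 1 - t) ((hasDerivAt_id t).const_sub 1)]
    simp
  simp only [h]
  rw [intervalIntegral.integral_comp_sub_left (fun t => speed A t)]
  simp

/-! ### Concatenation of curves -/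

theorem hasDerivAt_smoothTransition (x : ℝ) :
    HasDerivAt Real.smoothTransition (deriv Real.smoothTransition x) x :=
  ((Real.smoothTransition.contDiff (n := 1)).differentiable (by norm_num) x).hasDerivAt

theorem deriv_smoothTransition_nonneg (x : ℝ) : 0 ≤ deriv Real.smoothTransition x :=
  Real.smoothTransition.monotone.deriv_nonneg

theorem deriv_smoothTransition_of_nonpos {x : ℝ} (hx : x ≤ 0) :
    deriv Real.smoothTransition x = 0 :=
  IsLocalMin.deriv_eq_zero (Filter.Eventually.of_forall fun y => by
    rw [Real.smoothTransition.zero_of_nonpos hx]; exact Real.smoothTransition.nonneg y)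

theorem deriv_smoothTransition_of_one_le {x : ℝ} (hx : 1 ≤ x) :
    deriv Real.smoothTransition x = 0 :=
  IsLocalMax.deriv_eq_zero (Filter.Eventually.of_forall fun y => by
    rw [Real.smoothTransition.one_of_one_le hx]; exact Real.smoothTransition.le_one y)

/-- Two `C¹` curves which fit together can be joined to a `C¹` curve: reparametrized so that they
rest at the junction, they are multiplied as `A · A(1)⁻¹ · B`, with one factor moving at a time. -/
theorem exists_concat {A B : ℝ → SL2} (hA : IsC1 A) (hB : IsC1 B) (h : A 1 = B 0) :
    ∃ C : ℝ → SL2, IsC1 C ∧ C 0 = A 0 ∧ C 1 = B 1 ∧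
      curveLength C = curveLength A + curveLength B := by
  set p : ℝ → ℝ := fun t => Real.smoothTransition (2 * t) with hp
  set q : ℝ → ℝ := fun t => Real.smoothTransition (2 * t - 1) with hq
  set p' : ℝ → ℝ := fun t => deriv Real.smoothTransition (2 * t) * 2 with hp'
  set q' : ℝ → ℝ := fun t => deriv Real.smoothTransition (2 * t - 1) * 2 with hq'
  have hpd : ∀ t, HasDerivAt p (p' t) t := fun t =>
    (hasDerivAt_smoothTransition (2 * t)).comp (h := fun t => 2 * t) t
      (by simpa using (hasDerivAt_id t).const_mul (2 : ℝ))
  have hqd : ∀ t, HasDerivAt q (q' t) t := fun t =>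
    (hasDerivAt_smoothTransition (2 * t - 1)).comp (h := fun t => 2 * t - 1) t
      (by simpa using ((hasDerivAt_id t).const_mul (2 : ℝ)).sub_const 1)
  have hpc : ContDiff ℝ 1 p := (Real.smoothTransition.contDiff (n := 1)).comp (by fun_prop)
  have hqc : ContDiff ℝ 1 q := (Real.smoothTransition.contDiff (n := 1)).comp (by fun_prop)
  have hdc : Continuous (deriv Real.smoothTransition) :=
    (Real.smoothTransition.contDiff (n := 1)).continuous_deriv le_rfl
  have hp'c : Continuous p' := by fun_prop
  have hq'c : Continuous q' := by fun_prop
  have hp'0 : ∀ t, 0 ≤ p' t := fun t =>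
    mul_nonneg (deriv_smoothTransition_nonneg _) (by norm_num)
  have hq'0 : ∀ t, 0 ≤ q' t := fun t =>
    mul_nonneg (deriv_smoothTransition_nonneg _) (by norm_num)
  have hAp : IsC1 (fun t => A (p t)) := hA.comp hpc
  have hBq : IsC1 (fun t => B (q t)) := hB.comp hqc
  have hBq' : IsC1 (fun t => (A 1)⁻¹ * B (q t)) := (isC1_const _).mul hBq
  refine ⟨fun t => A (p t) * ((A 1)⁻¹ * B (q t)), hAp.mul hBq', ?_, ?_, ?_⟩
  · simp [hp, hq, h, Real.smoothTransition.zero_of_nonpos]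
  · have : (2 : ℝ) - 1 = 1 := by norm_num
    simp [hp, hq, Real.smoothTransition.one_of_one_le, this]
  · have hv : ∀ t, velocity (fun t => A (p t) * ((A 1)⁻¹ * B (q t))) t =
        (p' t • velocity A (p t)) * (((A 1)⁻¹ * B (q t) : SL2) : Matrix (Fin 2) (Fin 2) ℝ) +
        (A (p t) : Matrix (Fin 2) (Fin 2) ℝ) *
          ((((A 1)⁻¹ : SL2) : Matrix (Fin 2) (Fin 2) ℝ) * (q' t • velocity B (q t))) := fun t => by
      rw [velocity_mul hAp hBq', velocity_comp hA (hpd t), velocity_mul (isC1_const _) hBq,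
        velocity_const, velocity_comp hB (hqd t), Matrix.zero_mul, zero_add]
    have h1 : ∀ t ∈ uIcc (0 : ℝ) (1 / 2), speed (fun t => A (p t) * ((A 1)⁻¹ * B (q t))) t =
        (speed A ∘ p) t * p' t := fun t ht => by
      rw [uIcc_of_le (by norm_num)] at ht
      have hq0 : q t = 0 := Real.smoothTransition.zero_of_nonpos (by linarith [ht.2])
      have hq0' : q' t = 0 := by
        simp only [hq']; rw [deriv_smoothTransition_of_nonpos (by linarith [ht.2]), zero_mul]
      have e1 : speed (fun t => A (p t) * ((A 1)⁻¹ * B (q t))) t = speed (fun t => A (p t)) t := by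
        refine speed_congr ?_ ?_
        · rw [hq0, h, inv_mul_cancel, mul_one]
        · rw [hv, hq0, hq0', h, inv_mul_cancel, velocity_comp hA (hpd t)]
          simp
      rw [e1, speed_comp hA (hpd t), abs_of_nonneg (hp'0 t), mul_comm]; rfl
    have h2 : ∀ t ∈ uIcc (1 / 2 : ℝ) 1, speed (fun t => A (p t) * ((A 1)⁻¹ * B (q t))) t =
        (speed B ∘ q) t * q' t := fun t ht => by
      rw [uIcc_of_le (by norm_num)] at ht
      have hp1 : p t = 1 := Real.smoothTransition.one_of_one_le (by linarith [ht.1])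
      have hp1' : p' t = 0 := by
        simp only [hp']; rw [deriv_smoothTransition_of_one_le (by linarith [ht.1]), zero_mul]
      have e1 : speed (fun t => A (p t) * ((A 1)⁻¹ * B (q t))) t = speed (fun t => B (q t)) t := by
        refine speed_congr ?_ ?_
        · rw [hp1, mul_inv_cancel_left]
        · rw [hv, hp1, hp1', velocity_comp hB (hqd t), ← Matrix.mul_assoc,
            ← Matrix.SpecialLinearGroup.coe_mul, mul_inv_cancel]
          simp
      rw [e1, speed_comp hB (hqd t), abs_of_nonneg (hq'0 t), mul_comm]; rfl
    have hC := (hAp.mul hBq').continuous_speed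
    rw [curveLength_eq, ← intervalIntegral.integral_add_adjacent_intervals
      (hC.intervalIntegrable 0 (1 / 2)) (hC.intervalIntegrable (1 / 2) 1),
      intervalIntegral.integral_congr h1, intervalIntegral.integral_congr h2,
      intervalIntegral.integral_comp_mul_deriv (fun t _ => hpd t) hp'c.continuousOn
        hA.continuous_speed,
      intervalIntegral.integral_comp_mul_deriv (fun t _ => hqd t) hq'c.continuousOn
        hB.continuous_speed, curveLength_eq, curveLength_eq]
    have a1 : p 0 = 0 := by simp [hp]
    have a2 : p (1 / 2) = 1 := by simp [hp]
    have a3 : q (1 / 2) = 0 := by simp [hq]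
    have a4 : q 1 = 1 := by simp only [hq]; norm_num
    rw [a1, a2, a3, a4]

/-! ### The Riemannian distance on `PSL(2, ℝ)` -/

/-- The matrix `diag(e^{t/2}, e^{-t/2})`. -/
noncomputable def aM (t : ℝ) : SL2 :=
  ⟨!![Real.exp (t / 2), 0; 0, Real.exp (-t / 2)], by
    rw [Matrix.det_fin_two_of, ← Real.exp_add]
    ring_nf
    simp⟩

/-- The upper unipotent matrix with entry `s`. -/
noncomputable def bM (s : ℝ) : SL2 := ⟨!![1, s; 0, 1], by simp [Matrix.det_fin_two_of]⟩

/-- The lower unipotent matrix with entry `u`. -/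
noncomputable def cM (u : ℝ) : SL2 := ⟨!![1, 0; u, 1], by simp [Matrix.det_fin_two_of]⟩

theorem coe_aM (t : ℝ) :
    (aM t : Matrix (Fin 2) (Fin 2) ℝ) = !![Real.exp (t / 2), 0; 0, Real.exp (-t / 2)] := rfl
theorem coe_bM (s : ℝ) : (bM s : Matrix (Fin 2) (Fin 2) ℝ) = !![1, s; 0, 1] := rfl
theorem coe_cM (u : ℝ) : (cM u : Matrix (Fin 2) (Fin 2) ℝ) = !![1, 0; u, 1] := rfl

theorem a_eq (t : ℝ) : a t = toPSL (aM t) := rfl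
theorem b_eq (s : ℝ) : b s = toPSL (bM s) := rfl
theorem c_eq (u : ℝ) : c u = toPSL (cM u) := rfl

theorem toPSL_mul (A B : SL2) : toPSL (A * B) = toPSL A * toPSL B := rfl

theorem toPSL_inv (A : SL2) : toPSL A⁻¹ = (toPSL A)⁻¹ := rfl

theorem toPSL_one : toPSL 1 = 1 := rfl

theorem toPSL_surjective : Function.Surjective toPSL := QuotientGroup.mk_surjective

theorem toPSL_neg (A : SL2) : toPSL (-A) = toPSL A := by
  refine QuotientGroup.eq.mpr ?_
  rw [Matrix.SpecialLinearGroup.mem_center_iff]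
  refine ⟨-1, by simp, ?_⟩
  have h : (-A)⁻¹ * A = -1 := by
    rw [inv_mul_eq_iff_eq_mul]; simp
  rw [h]
  ext i j
  fin_cases i <;> fin_cases j <;> simp

theorem toPSL_eq_iff {A B : SL2} : toPSL A = toPSL B ↔ A = B ∨ A = -B := by
  refine ⟨fun h => ?_, ?_⟩
  · have h1 := QuotientGroup.eq.mp h
    rw [Matrix.SpecialLinearGroup.mem_center_iff] at h1
    obtain ⟨r, hr, h2⟩ := h1
    have h3 : r = 1 ∨ r = -1 := by
      rw [Fintype.card_fin] at hr
      have := mul_eq_zero.mp (show (r - 1) * (r + 1) = 0 by linear_combination hr)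
      exact this.imp sub_eq_zero.mp eq_neg_of_add_eq_zero_left
    have hB : (B : Matrix (Fin 2) (Fin 2) ℝ) = r • (A : Matrix (Fin 2) (Fin 2) ℝ) := by
      have : B = A * (A⁻¹ * B) := by group
      rw [this, Matrix.SpecialLinearGroup.coe_mul, ← h2]
      simp [← Matrix.smul_one_eq_diagonal]
    rcases h3 with rfl | rfl
    · left
      ext i j
      rw [hB, one_smul]
    · right
      ext i j
      rw [Matrix.SpecialLinearGroup.coe_neg, hB]
      simp
  · rintro (rfl | rfl)
    · rfl
    · exact toPSL_neg B

/-- The lengths of `C¹` curves from `g` to `h`. -/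
def pathLengths (g h : PSL2R) : Set ℝ :=
  {r : ℝ | ∃ A : ℝ → SL2, IsC1 A ∧ toPSL (A 0) = g ∧ toPSL (A 1) = h ∧ r = curveLength A}

theorem dG_eq (g h : PSL2R) : dG g h = sInf (pathLengths g h) := rfl

theorem pathLengths_bddBelow (g h : PSL2R) : BddBelow (pathLengths g h) :=
  ⟨0, by rintro _ ⟨A, -, -, -, rfl⟩; exact curveLength_nonneg A⟩

theorem dG_nonneg (g h : PSL2R) : 0 ≤ dG g h :=
  Real.sInf_nonneg (by rintro _ ⟨A, -, -, -, rfl⟩; exact curveLength_nonneg A)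

theorem pathLengths_add {g h k : PSL2R} {r r' : ℝ} (hr : r ∈ pathLengths g h)
    (hr' : r' ∈ pathLengths h k) : r + r' ∈ pathLengths g k := by
  obtain ⟨A, hA, hA0, hA1, rfl⟩ := hr
  obtain ⟨B, hB, hB0, hB1, rfl⟩ := hr'
  -- the lifts of `h` may differ by a central factor, which is moved to the second curve
  have hz : toPSL (A 1 * (B 0)⁻¹) = 1 := by
    rw [toPSL_mul, toPSL_inv, hA1, hB0, mul_inv_cancel]
  obtain ⟨C, hC, hC0, hC1, hCl⟩ :=
    exists_concat hA ((isC1_const (A 1 * (B 0)⁻¹)).mul hB) (by group)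
  refine ⟨C, hC, by rw [hC0, hA0], ?_, ?_⟩
  · rw [hC1, toPSL_mul, hz, hB1, one_mul]
  · rw [hCl, curveLength_const_mul hB]

theorem pathLengths_symm {g h : PSL2R} {r : ℝ} (hr : r ∈ pathLengths g h) :
    r ∈ pathLengths h g := by
  obtain ⟨A, hA, hA0, hA1, rfl⟩ := hr
  refine ⟨fun t => A (1 - t), hA.comp (by fun_prop), by simpa using hA1, by simpa using hA0, ?_⟩
  rw [curveLength_reverse hA]

theorem pathLengths_mul_left {g h : PSL2R} (k : PSL2R) {r : ℝ} (hr : r ∈ pathLengths g h) :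
    r ∈ pathLengths (k * g) (k * h) := by
  obtain ⟨A, hA, hA0, hA1, rfl⟩ := hr
  obtain ⟨P, rfl⟩ := toPSL_surjective k
  exact ⟨fun t => P * A t, (isC1_const P).mul hA, by rw [toPSL_mul, hA0],
    by rw [toPSL_mul, hA1], (curveLength_const_mul hA P).symm⟩

theorem mem_pathLengths_b (g : PSL2R) (s : ℝ) : |s| ∈ pathLengths g (g * b s) := by
  suffices h : |s| ∈ pathLengths 1 (b s) by simpa using pathLengths_mul_left g h
  refine ⟨fun t => bM (s * t), ?_, ?_, ?_, ?_⟩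
  · intro i j
    fin_cases i <;> fin_cases j <;> simp [coe_bM] <;> fun_prop
  · rw [← toPSL_one]
    congr 1
    ext i j
    fin_cases i <;> fin_cases j <;> simp [coe_bM]
  · simp only [b_eq, mul_one]
  · have h : ∀ t, speed (fun t => bM (s * t)) t = |s| := fun t => by
      have hv : velocity (fun t => bM (s * t)) t = !![0, s; 0, 0] := by
        ext i j
        fin_cases i <;> fin_cases j <;> simp [velocity, coe_bM]
      rw [speed, hv, ← Real.sqrt_sq_eq_abs]
      congr 1
      simp [coe_bM, Matrix.adjugate_fin_two_of]
    rw [curveLength_eq]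
    simp [h]

theorem mem_pathLengths_c (g : PSL2R) (s : ℝ) : |s| ∈ pathLengths g (g * c s) := by
  suffices h : |s| ∈ pathLengths 1 (c s) by simpa using pathLengths_mul_left g h
  refine ⟨fun t => cM (s * t), ?_, ?_, ?_, ?_⟩
  · intro i j
    fin_cases i <;> fin_cases j <;> simp [coe_cM] <;> fun_prop
  · rw [← toPSL_one]
    congr 1
    ext i j
    fin_cases i <;> fin_cases j <;> simp [coe_cM]
  · simp only [c_eq, mul_one]
  · have h : ∀ t, speed (fun t => cM (s * t)) t = |s| := fun t => by
      have hv : velocity (fun t => cM (s * t)) t = !![0, 0; s, 0] := by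
        ext i j
        fin_cases i <;> fin_cases j <;> simp [velocity, coe_cM]
      rw [speed, hv, ← Real.sqrt_sq_eq_abs]
      congr 1
      simp [coe_cM, Matrix.adjugate_fin_two_of]
    rw [curveLength_eq]
    simp [h]

theorem mem_pathLengths_a (g : PSL2R) (τ : ℝ) : |τ| / Real.sqrt 2 ∈ pathLengths g (g * a τ) := by
  suffices h : |τ| / Real.sqrt 2 ∈ pathLengths 1 (a τ) by simpa using pathLengths_mul_left g h
  refine ⟨fun t => aM (τ * t), ?_, ?_, ?_, ?_⟩
  · intro i j
    fin_cases i <;> fin_cases j <;> simp [coe_aM] <;> fun_prop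
  · rw [← toPSL_one]
    congr 1
    ext i j
    fin_cases i <;> fin_cases j <;> simp [coe_aM]
  · simp only [a_eq, mul_one]
  · have h : ∀ t, speed (fun t => aM (τ * t)) t = |τ| / Real.sqrt 2 := fun t => by
      have h1 : HasDerivAt (fun t : ℝ => Real.exp (τ * t / 2))
          (Real.exp (τ * t / 2) * (τ / 2)) t := by
        refine HasDerivAt.exp ?_
        simpa using ((hasDerivAt_id t).const_mul τ).div_const 2
      have h2 : HasDerivAt (fun t : ℝ => Real.exp (-(τ * t) / 2))
          (Real.exp (-(τ * t) / 2) * (-τ / 2)) t := by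
        refine HasDerivAt.exp ?_
        simpa using ((hasDerivAt_id t).const_mul τ).neg.div_const 2
      have hv : velocity (fun t => aM (τ * t)) t =
          !![Real.exp (τ * t / 2) * (τ / 2), 0; 0, Real.exp (-(τ * t) / 2) * (-τ / 2)] := by
        ext i j
        fin_cases i <;> fin_cases j <;> simp [velocity, coe_aM, h1.deriv, h2.deriv]
      have hm : Real.exp (τ * t / 2) * Real.exp (-(τ * t) / 2) = 1 := by
        rw [← Real.exp_add]; ring_nf; simp
      have hm' : ∀ y, Real.exp (τ * t / 2) * (Real.exp (-(τ * t) / 2) * y) = y := fun y => by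
        rw [← mul_assoc, hm, one_mul]
      have hm'' : ∀ y, Real.exp (-(τ * t) / 2) * (Real.exp (τ * t / 2) * y) = y := fun y => by
        rw [← mul_assoc, mul_comm (Real.exp (-(τ * t) / 2)), hm, one_mul]
      rw [speed, hv, ← Real.sqrt_sq_eq_abs, ← Real.sqrt_div (sq_nonneg _)]
      congr 1
      simp [coe_aM, Matrix.adjugate_fin_two_of, hm', hm'']
      ring
    rw [curveLength_eq]
    simp [h]

/-- The factorization of a matrix with positive upper left entry. -/
theorem eq_cM_mul_aM_mul_bM (Q : SL2) (h : 0 < Q 0 0) :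
    Q = cM (Q 1 0 / Q 0 0) * aM (2 * Real.log (Q 0 0)) * bM (Q 0 1 / Q 0 0) := by
  have hd : Q 0 0 * Q 1 1 - Q 0 1 * Q 1 0 = 1 := by
    rw [← Matrix.det_fin_two]; exact Q.2
  have he : Real.exp (2 * Real.log (Q 0 0) / 2) = Q 0 0 := by
    rw [mul_div_cancel_left₀ _ (by norm_num), Real.exp_log h]
  have he' : Real.exp (-(2 * Real.log (Q 0 0)) / 2) = (Q 0 0)⁻¹ := by
    rw [neg_div, Real.exp_neg, he]
  ext i j
  fin_cases i <;> fin_cases j <;>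
    simp [coe_cM, coe_aM, coe_bM, Matrix.mul_apply, Fin.sum_univ_two, Real.exp_log h, he']
  all_goals field_simp
  linarith

/-- The group is connected by `C¹` curves, so that no `dG` is an infimum over the empty set. -/
theorem pathLengths_nonempty (g h : PSL2R) : (pathLengths g h).Nonempty := by
  suffices key : ∀ k : PSL2R, (pathLengths 1 k).Nonempty by
    obtain ⟨r, hr⟩ := key (g⁻¹ * h)
    exact ⟨r, by simpa using pathLengths_mul_left g hr⟩
  have hpos : ∀ Q : SL2, 0 < Q 0 0 → (pathLengths 1 (toPSL Q)).Nonempty := fun Q hQ => by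
    rw [eq_cM_mul_aM_mul_bM Q hQ, toPSL_mul, toPSL_mul]
    have h1 := pathLengths_add (mem_pathLengths_c 1 (Q 1 0 / Q 0 0))
      (mem_pathLengths_a _ (2 * Real.log (Q 0 0)))
    rw [one_mul] at h1
    exact ⟨_, pathLengths_add h1 (mem_pathLengths_b _ (Q 0 1 / Q 0 0))⟩
  have hne : ∀ Q : SL2, Q 0 0 ≠ 0 → (pathLengths 1 (toPSL Q)).Nonempty := fun Q hQ => by
    rcases lt_or_gt_of_ne hQ with h | h
    · rw [← toPSL_neg]
      exact hpos _ (by simpa using h)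
    · exact hpos Q h
  intro k
  obtain ⟨Q, rfl⟩ := toPSL_surjective k
  by_cases hQ : Q 0 0 = 0
  · -- move the upper left entry away from zero by an upper unipotent factor
    have hd : Q 0 0 * Q 1 1 - Q 0 1 * Q 1 0 = 1 := by
      rw [← Matrix.det_fin_two]; exact Q.2
    have h10 : Q 1 0 ≠ 0 := fun h0 => by rw [hQ, h0] at hd; norm_num at hd
    obtain ⟨r, hr⟩ := hne (bM 1 * Q) (by simpa [coe_bM, Matrix.mul_apply, hQ] using h10)
    have h1 := pathLengths_mul_left (b 1)⁻¹ hr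
    have h2 := pathLengths_mul_left (b 1)⁻¹ (mem_pathLengths_b 1 1)
    rw [toPSL_mul, ← b_eq, inv_mul_cancel_left, mul_one] at h1
    rw [one_mul, mul_one, inv_mul_cancel] at h2
    exact ⟨_, pathLengths_add (pathLengths_symm h2) h1⟩
  · exact hne Q hQ

theorem dG_le {g h : PSL2R} {r : ℝ} (hr : r ∈ pathLengths g h) : dG g h ≤ r :=
  csInf_le (pathLengths_bddBelow g h) hr

theorem exists_pathLength_lt {g h : PSL2R} {r : ℝ} (hr : dG g h < r) :
    ∃ l ∈ pathLengths g h, l < r :=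
  exists_lt_of_csInf_lt (pathLengths_nonempty g h) hr

theorem dG_triangle (g h k : PSL2R) : dG g k ≤ dG g h + dG h k := by
  refine le_of_forall_pos_lt_add fun η hη => ?_
  obtain ⟨r, hr, hr'⟩ := exists_pathLength_lt (show dG g h < dG g h + η / 2 by linarith)
  obtain ⟨l, hl, hl'⟩ := exists_pathLength_lt (show dG h k < dG h k + η / 2 by linarith)
  linarith [dG_le (pathLengths_add hr hl)]

theorem dG_comm (g h : PSL2R) : dG g h = dG h g := by
  have : pathLengths g h = pathLengths h g :=
    Set.ext fun r => ⟨pathLengths_symm, pathLengths_symm⟩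
  rw [dG_eq, dG_eq, this]

theorem dG_mul_left (k g h : PSL2R) : dG (k * g) (k * h) = dG g h := by
  have : pathLengths (k * g) (k * h) = pathLengths g h :=
    Set.ext fun r => ⟨fun hr => by simpa using pathLengths_mul_left k⁻¹ hr, pathLengths_mul_left k⟩
  rw [dG_eq, dG_eq, this]

theorem dG_mul_a_le (g : PSL2R) (t : ℝ) : dG g (g * a t) ≤ |t| / Real.sqrt 2 :=
  dG_le (mem_pathLengths_a g t)

theorem dG_mul_b_le (g : PSL2R) (s : ℝ) : dG g (g * b s) ≤ |s| := dG_le (mem_pathLengths_b g s)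

theorem dG_mul_c_le (g : PSL2R) (u : ℝ) : dG g (g * c u) ≤ |u| := dG_le (mem_pathLengths_c g u)

theorem dG_mul_cb_le (g : PSL2R) (u s : ℝ) : dG g (g * c u * b s) ≤ |u| + |s| :=
  (dG_triangle _ (g * c u) _).trans (add_le_add (dG_mul_c_le _ _) (dG_mul_b_le _ _))

theorem aM_add (t t' : ℝ) : aM (t + t') = aM t * aM t' := by
  ext i j
  fin_cases i <;> fin_cases j <;>
    simp [coe_aM, Matrix.mul_apply, Fin.sum_univ_two, ← Real.exp_add] <;> ring_nf

theorem a_add (t t' : ℝ) : a (t + t') = a t * a t' := by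
  rw [a_eq, a_eq, a_eq, ← toPSL_mul, aM_add]

theorem a_zero : a 0 = 1 := by
  have h := a_add 0 0
  rw [add_zero] at h
  exact right_eq_mul.mp h

theorem a_neg (t : ℝ) : a (-t) = (a t)⁻¹ := by
  refine eq_inv_of_mul_eq_one_left ?_
  rw [← a_add, neg_add_cancel, a_zero]

/-! ### The distance on the quotient -/

section

variable {Γ : Subgroup PSL2R}

theorem rightTranslate_pt (g k : PSL2R) : rightTranslate Γ k (pt Γ g) = pt Γ (g * k) := rfl

theorem pt_surjective : Function.Surjective (pt Γ) := Quotient.mk_surjective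

theorem pt_eq_iff {g h : PSL2R} : pt Γ g = pt Γ h ↔ ∃ γ ∈ Γ, h = γ * g := by
  refine Quotient.eq.trans ?_
  rw [QuotientGroup.rightRel_apply]
  exact ⟨fun h1 => ⟨_, h1, by group⟩, by rintro ⟨γ, hγ, rfl⟩; simpa using hγ⟩

theorem pt_mul_left {γ : PSL2R} (hγ : γ ∈ Γ) (g : PSL2R) : pt Γ (γ * g) = pt Γ g :=
  (pt_eq_iff.mpr ⟨γ, hγ, rfl⟩).symm

theorem rightTranslate_mul (k l : PSL2R) (x : PhaseSpace Γ) :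
    rightTranslate Γ (k * l) x = rightTranslate Γ l (rightTranslate Γ k x) := by
  obtain ⟨g, rfl⟩ := pt_surjective x
  simp only [rightTranslate_pt, mul_assoc]

theorem rightTranslate_one (x : PhaseSpace Γ) : rightTranslate Γ 1 x = x := by
  obtain ⟨g, rfl⟩ := pt_surjective x
  simp only [rightTranslate_pt, mul_one]

theorem flow_eq (t : ℝ) (x : PhaseSpace Γ) : flow Γ t x = rightTranslate Γ (a t) x := rfl

theorem flow_add (t t' : ℝ) (x : PhaseSpace Γ) : flow Γ (t + t') x = flow Γ t' (flow Γ t x) := by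
  rw [flow_eq, flow_eq, flow_eq, a_add, rightTranslate_mul]

theorem flow_zero (x : PhaseSpace Γ) : flow Γ 0 x = x := by
  rw [flow_eq, a_zero, rightTranslate_one]

theorem dX_le (g h : PSL2R) : dX Γ (pt Γ g) (pt Γ h) ≤ dG g h :=
  csInf_le ⟨0, by rintro _ ⟨g₁, g₂, -, -, rfl⟩; exact dG_nonneg _ _⟩ ⟨g, h, rfl, rfl, rfl⟩

theorem exists_dG_lt {g h : PSL2R} {r : ℝ} (hr : dX Γ (pt Γ g) (pt Γ h) < r) :
    ∃ γ ∈ Γ, dG g (γ * h) < r := by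
  obtain ⟨_, ⟨g₁, h₁, hg, hh, rfl⟩, hl⟩ :=
    exists_lt_of_csInf_lt (s := {r : ℝ | ∃ g₁ g₂ : PSL2R, pt Γ g₁ = pt Γ g ∧ pt Γ g₂ = pt Γ h ∧
      r = dG g₁ g₂}) ⟨_, g, h, rfl, rfl, rfl⟩ hr
  obtain ⟨α, hα, rfl⟩ := pt_eq_iff.mp hg.symm
  obtain ⟨β, hβ, rfl⟩ := pt_eq_iff.mp hh.symm
  refine ⟨α⁻¹ * β, Γ.mul_mem (Γ.inv_mem hα) hβ, ?_⟩
  rw [← dG_mul_left α]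
  simpa [mul_assoc] using hl

theorem dX_comm (x y : PhaseSpace Γ) : dX Γ x y = dX Γ y x := by
  unfold dX
  congr 1
  ext r
  exact ⟨fun ⟨g, h, hg, hh, hr⟩ => ⟨h, g, hh, hg, by rw [hr, dG_comm]⟩,
    fun ⟨g, h, hg, hh, hr⟩ => ⟨h, g, hh, hg, by rw [hr, dG_comm]⟩⟩

theorem dX_triangle (x y z : PhaseSpace Γ) : dX Γ x z ≤ dX Γ x y + dX Γ y z := by
  obtain ⟨g, rfl⟩ := pt_surjective x
  obtain ⟨h, rfl⟩ := pt_surjective y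
  obtain ⟨k, rfl⟩ := pt_surjective z
  refine le_of_forall_pos_lt_add fun η hη => ?_
  obtain ⟨γ, hγ, h1⟩ := exists_dG_lt (Γ := Γ) (g := g) (h := h)
    (lt_add_of_pos_right _ (half_pos hη))
  obtain ⟨δ, hδ, h2⟩ := exists_dG_lt (Γ := Γ) (g := h) (h := k)
    (lt_add_of_pos_right _ (half_pos hη))
  have h3 := dX_le (Γ := Γ) g (γ * (δ * k))
  rw [pt_mul_left hγ, pt_mul_left hδ] at h3
  have h4 := dG_triangle g (γ * h) (γ * (δ * k))
  rw [dG_mul_left] at h4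
  linarith

/-- The right action of `G` on `X` displaces every point by at most the size of the group element:
this is left invariance of the metric. -/
theorem dX_rightTranslate_le (x : PhaseSpace Γ) (k : PSL2R) :
    dX Γ (rightTranslate Γ k x) x ≤ dG 1 k := by
  obtain ⟨g, rfl⟩ := pt_surjective x
  rw [dX_comm]
  refine (dX_le g (g * k)).trans_eq ?_
  have := dG_mul_left g 1 k
  rwa [mul_one] at this

theorem dX_flow_le (x : PhaseSpace Γ) (t : ℝ) : dX Γ (flow Γ t x) x ≤ |t| / Real.sqrt 2 := by
  refine (dX_rightTranslate_le x (a t)).trans ?_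
  simpa using dG_mul_a_le 1 t

end

/-! ### Small distance forces closeness in the group topology -/

theorem velocity_eq_mul (A : ℝ → SL2) (t : ℝ) :
    velocity A t = (A t : Matrix (Fin 2) (Fin 2) ℝ) *
      ((((A t)⁻¹ : SL2) : Matrix (Fin 2) (Fin 2) ℝ) * velocity A t) := by
  rw [← Matrix.mul_assoc, ← Matrix.SpecialLinearGroup.coe_mul, mul_inv_cancel]
  simp

theorem abs_entry_le_speed (A : ℝ → SL2) (t : ℝ) (i j : Fin 2) :
    |((((A t)⁻¹ : SL2) : Matrix (Fin 2) (Fin 2) ℝ) * velocity A t) i j| ≤ speed A t := by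
  refine Real.abs_le_sqrt ?_
  refine le_trans ?_ (Finset.single_le_sum (f := fun i => ∑ j,
    ((((A t)⁻¹ : SL2) : Matrix (Fin 2) (Fin 2) ℝ) * velocity A t) i j ^ 2)
    (fun i _ => Finset.sum_nonneg fun j _ => sq_nonneg _) (Finset.mem_univ i))
  exact Finset.single_le_sum (f := fun j =>
    ((((A t)⁻¹ : SL2) : Matrix (Fin 2) (Fin 2) ℝ) * velocity A t) i j ^ 2)
    (fun j _ => sq_nonneg _) (Finset.mem_univ j)

/-- A short curve starting at the identity stays close to it. With `K` the largest deviation along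
the curve, integration of `A' = A (A⁻¹ A')` bounds `K` by `4 (K + 1)` times the length. -/
theorem abs_entry_sub_le {A : ℝ → SL2} (hA : IsC1 A) (h0 : A 0 = 1) (hl : curveLength A ≤ 1 / 8)
    (i j : Fin 2) :
    |(A 1 : Matrix (Fin 2) (Fin 2) ℝ) i j - (1 : Matrix (Fin 2) (Fin 2) ℝ) i j| ≤
      8 * curveLength A := by
  set l := curveLength A with hldef
  set S : ℝ → ℝ := fun t => ∑ i, ∑ j,
    |(A t : Matrix (Fin 2) (Fin 2) ℝ) i j - (1 : Matrix (Fin 2) (Fin 2) ℝ) i j| with hS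
  have hAc : ∀ i j, Continuous fun t => (A t : Matrix (Fin 2) (Fin 2) ℝ) i j := fun i j =>
    (hA i j).continuous
  have hSc : Continuous S := continuous_finsetSum _ fun i _ => continuous_finsetSum _ fun j _ =>
    ((hAc i j).sub continuous_const).abs
  obtain ⟨m, hm, hmax⟩ := isCompact_Icc.exists_isMaxOn (nonempty_Icc.mpr (zero_le_one' ℝ))
    hSc.continuousOn
  have hle : ∀ t i j, |(A t : Matrix (Fin 2) (Fin 2) ℝ) i j - (1 : Matrix (Fin 2) (Fin 2) ℝ) i j| ≤
      S t := fun t i j =>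
    (Finset.single_le_sum (f := fun j =>
      |(A t : Matrix (Fin 2) (Fin 2) ℝ) i j - (1 : Matrix (Fin 2) (Fin 2) ℝ) i j|)
      (fun j _ => abs_nonneg _) (Finset.mem_univ j)).trans
    (Finset.single_le_sum (f := fun i => ∑ j,
      |(A t : Matrix (Fin 2) (Fin 2) ℝ) i j - (1 : Matrix (Fin 2) (Fin 2) ℝ) i j|)
      (fun i _ => Finset.sum_nonneg fun j _ => abs_nonneg _) (Finset.mem_univ i))
  have hrow : ∀ t i, |(A t : Matrix (Fin 2) (Fin 2) ℝ) i 0| + |(A t : Matrix (Fin 2) (Fin 2) ℝ) i 1|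
      ≤ S t + 1 := fun t i => by
    have e : S t =
        |(A t : Matrix (Fin 2) (Fin 2) ℝ) 0 0 - 1| + |(A t : Matrix (Fin 2) (Fin 2) ℝ) 0 1|
        + (|(A t : Matrix (Fin 2) (Fin 2) ℝ) 1 0|
        + |(A t : Matrix (Fin 2) (Fin 2) ℝ) 1 1 - 1|) := by
      simp [hS, Fin.sum_univ_two]
    have h1 := abs_sub_abs_le_abs_sub ((A t : Matrix (Fin 2) (Fin 2) ℝ) 0 0) 1
    have h2 := abs_sub_abs_le_abs_sub ((A t : Matrix (Fin 2) (Fin 2) ℝ) 1 1) 1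
    rw [abs_one] at h1 h2
    have h3 := abs_nonneg ((A t : Matrix (Fin 2) (Fin 2) ℝ) 0 1)
    have h4 := abs_nonneg ((A t : Matrix (Fin 2) (Fin 2) ℝ) 1 0)
    have h5 := abs_nonneg ((A t : Matrix (Fin 2) (Fin 2) ℝ) 0 0 - 1)
    have h6 := abs_nonneg ((A t : Matrix (Fin 2) (Fin 2) ℝ) 1 1 - 1)
    fin_cases i <;> simp only [Fin.zero_eta, Fin.mk_one] <;> linarith
  have hvel : ∀ t ∈ Icc (0 : ℝ) 1, ∀ i j, |velocity A t i j| ≤ (S m + 1) * speed A t := by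
    intro t ht i j
    rw [velocity_eq_mul, Matrix.mul_apply, Fin.sum_univ_two]
    refine (abs_add_le _ _).trans ?_
    rw [abs_mul, abs_mul]
    have h1 := mul_le_mul_of_nonneg_left (abs_entry_le_speed A t 0 j)
      (abs_nonneg ((A t : Matrix (Fin 2) (Fin 2) ℝ) i 0))
    have h2 := mul_le_mul_of_nonneg_left (abs_entry_le_speed A t 1 j)
      (abs_nonneg ((A t : Matrix (Fin 2) (Fin 2) ℝ) i 1))
    have h3 := mul_le_mul_of_nonneg_right ((hrow t i).trans (add_le_add_left (hmax ht) 1))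
      (speed_nonneg A t)
    linarith
  have hSm : 0 ≤ S m := (abs_nonneg _).trans (hle m 0 0)
  have hent : ∀ i j, |(A m : Matrix (Fin 2) (Fin 2) ℝ) i j - (1 : Matrix (Fin 2) (Fin 2) ℝ) i j| ≤
      (S m + 1) * l := by
    intro i j
    have hvc : Continuous fun t => velocity A t i j := (hA i j).continuous_deriv le_rfl
    have h1 : ∫ t in (0 : ℝ)..m, velocity A t i j =
        (A m : Matrix (Fin 2) (Fin 2) ℝ) i j - (A 0 : Matrix (Fin 2) (Fin 2) ℝ) i j :=
      intervalIntegral.integral_deriv_eq_sub (fun t _ => hA.differentiableAt i j t)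
        (hvc.intervalIntegrable _ _)
    rw [h0, Matrix.SpecialLinearGroup.coe_one] at h1
    rw [← h1]
    have hsc := hA.continuous_speed
    calc |∫ t in (0 : ℝ)..m, velocity A t i j|
        ≤ ∫ t in (0 : ℝ)..m, |velocity A t i j| :=
          intervalIntegral.abs_integral_le_integral_abs hm.1
      _ ≤ ∫ t in (0 : ℝ)..m, (S m + 1) * speed A t :=
          intervalIntegral.integral_mono_on hm.1 (hvc.abs.intervalIntegrable _ _)
            ((continuous_const.mul hsc).intervalIntegrable _ _)
            fun t ht => hvel t ⟨ht.1, ht.2.trans hm.2⟩ i j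
      _ ≤ ∫ t in (0 : ℝ)..1, (S m + 1) * speed A t :=
          intervalIntegral.integral_mono_interval le_rfl hm.1 hm.2
            (Filter.Eventually.of_forall fun t => mul_nonneg (by linarith) (speed_nonneg A t))
            ((continuous_const.mul hsc).intervalIntegrable _ _)
      _ = (S m + 1) * l := by
          rw [intervalIntegral.integral_const_mul, hldef, curveLength_eq]
  have hK : S m ≤ 4 * ((S m + 1) * l) := by
    have e : S m = |(A m : Matrix (Fin 2) (Fin 2) ℝ) 0 0 - (1 : Matrix (Fin 2) (Fin 2) ℝ) 0 0|
        + |(A m : Matrix (Fin 2) (Fin 2) ℝ) 0 1 - (1 : Matrix (Fin 2) (Fin 2) ℝ) 0 1|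
        + (|(A m : Matrix (Fin 2) (Fin 2) ℝ) 1 0 - (1 : Matrix (Fin 2) (Fin 2) ℝ) 1 0|
        + |(A m : Matrix (Fin 2) (Fin 2) ℝ) 1 1 - (1 : Matrix (Fin 2) (Fin 2) ℝ) 1 1|) := by
      simp only [hS, Fin.sum_univ_two]
    rw [e]
    rw [← e]
    linarith [hent 0 0, hent 0 1, hent 1 0, hent 1 1]
  have hl0 : 0 ≤ l := curveLength_nonneg A
  have h1 : S 1 ≤ S m := hmax (right_mem_Icc.mpr zero_le_one)
  have h2 := hle 1 i j
  nlinarith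

/-- Every neighbourhood of the identity contains a ball for the Riemannian distance. -/
theorem exists_dG_ball_subset {N : Set PSL2R} (hN : N ∈ nhds (1 : PSL2R)) :
    ∃ σ > 0, ∀ h : PSL2R, dG 1 h ≤ σ → h ∈ N := by
  have hc : Continuous toPSL := continuous_quotient_mk'
  have h1 : toPSL ⁻¹' N ∈ nhds (1 : SL2) := hc.continuousAt.preimage_mem_nhds hN
  rw [show nhds (1 : SL2) = Filter.comap Subtype.val (nhds _) from nhds_induced _ _] at h1
  obtain ⟨V, hV, hVN⟩ := h1
  have hV' : V ∈ nhds (fun i j => (1 : Matrix (Fin 2) (Fin 2) ℝ) i j : Fin 2 → Fin 2 → ℝ) := hV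
  obtain ⟨δ, hδ, hball⟩ := Metric.mem_nhds_iff.mp hV'
  refine ⟨min (1 / 16) (δ / 32), by positivity, fun h hh => ?_⟩
  have hlt : dG 1 h < min (1 / 8) (δ / 16) := by
    refine hh.trans_lt (lt_min ((min_le_left _ _).trans_lt (by norm_num))
      ((min_le_right _ _).trans_lt (by linarith)))
  obtain ⟨_, ⟨A, hA, hA0, hA1, rfl⟩, hl⟩ := exists_pathLength_lt hlt
  have hB : IsC1 (fun t => (A 0)⁻¹ * A t) := (isC1_const _).mul hA
  have hBl : curveLength (fun t => (A 0)⁻¹ * A t) = curveLength A := curveLength_const_mul hA _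
  have hent := abs_entry_sub_le hB (inv_mul_cancel _)
    (by rw [hBl]; exact (hl.trans_le (min_le_left _ _)).le)
  rw [hBl] at hent
  have hmem : (A 0)⁻¹ * A 1 ∈ toPSL ⁻¹' N := by
    refine hVN (hball ?_)
    refine (dist_pi_lt_iff hδ).mpr fun i => (dist_pi_lt_iff hδ).mpr fun j => ?_
    refine (Real.dist_eq _ _).trans_lt ?_
    have h3 := hent i j
    have h4 := hl.trans_le (min_le_right _ _)
    refine lt_of_le_of_lt h3 (by linarith)
  rw [mem_preimage, toPSL_mul, toPSL_inv, hA0, hA1, inv_one, one_mul] at hmem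
  exact hmem

/-! ### The displacement constant -/

theorem isOpen_image_pt {Γ : Subgroup PSL2R} {U : Set PSL2R} (hU : IsOpen U) :
    IsOpen (pt Γ '' U) := by
  have h : IsOpen (pt Γ ⁻¹' (pt Γ '' U)) := by
    have e : pt Γ ⁻¹' (pt Γ '' U) = ⋃ γ ∈ Γ, (fun g => γ * g) ⁻¹' U := by
      ext g
      simp only [mem_preimage, mem_image, mem_iUnion, exists_prop]
      constructor
      · rintro ⟨h, hh, he⟩
        obtain ⟨γ, hγ, rfl⟩ := pt_eq_iff.mp he.symm
        exact ⟨γ, hγ, hh⟩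
      · rintro ⟨γ, hγ, hg⟩
        exact ⟨_, hg, pt_mul_left hγ g⟩
    rw [e]
    exact isOpen_biUnion fun γ _ => hU.preimage (continuous_const_mul γ)
  exact h

/-- Conjugates of nontrivial lattice elements stay away from the identity: near each point this is
discreteness of `Γ`, and compactness of the quotient makes it uniform. -/
theorem exists_isDisplacementConst (Γ : Subgroup PSL2R) [DiscreteTopology Γ]
    [CompactSpace (PhaseSpace Γ)] : ∃ σ₀ : ℝ, IsDisplacementConst Γ σ₀ := by
  obtain ⟨W, hW, hW1, hWΓ⟩ :
      ∃ W : Set PSL2R, IsOpen W ∧ 1 ∈ W ∧ ∀ γ, γ ∈ Γ → γ ∈ W → γ = 1 := by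
    obtain ⟨W, hW, hWe⟩ := isOpen_induced_iff.mp (isOpen_discrete ({1} : Set Γ))
    refine ⟨W, hW, ?_, fun γ hγ hγW => ?_⟩
    · have : (1 : Γ) ∈ Subtype.val ⁻¹' W := by rw [hWe]; rfl
      exact this
    · have : (⟨γ, hγ⟩ : Γ) ∈ ({1} : Set Γ) := by rw [← hWe]; exact hγW
      exact congrArg Subtype.val this
  have hloc : ∀ g : PSL2R, ∃ U : Set PSL2R, IsOpen U ∧ g ∈ U ∧ ∃ σ > 0, ∀ h ∈ U, ∀ γ ∈ Γ, γ ≠ 1 →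
      σ < dG (γ * h) h := by
    intro g
    have hc : Continuous fun q : PSL2R × PSL2R => q.1 * q.2 * q.1⁻¹ := by fun_prop
    have hmem : (fun q : PSL2R × PSL2R => q.1 * q.2 * q.1⁻¹) ⁻¹' W ∈ nhds (g, (1 : PSL2R)) :=
      hc.continuousAt.preimage_mem_nhds (hW.mem_nhds (by simpa using hW1))
    obtain ⟨U, hU, hgU, N, hN, h1N, hUN⟩ := mem_nhds_prod_iff'.mp hmem |>.imp fun U h => by
      obtain ⟨N, hU, hg, hN, h1, h2⟩ := h
      exact (⟨hU, hg, N, hN, h1, h2⟩ : IsOpen U ∧ g ∈ U ∧ ∃ N, IsOpen N ∧ (1 : PSL2R) ∈ N ∧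
        U ×ˢ N ⊆ (fun q : PSL2R × PSL2R => q.1 * q.2 * q.1⁻¹) ⁻¹' W)
    obtain ⟨σ, hσ, hball⟩ := exists_dG_ball_subset (hN.mem_nhds h1N)
    refine ⟨U, hU, hgU, σ, hσ, fun h hh γ hγ hne => ?_⟩
    by_contra! hle
    have h1 : dG 1 (h⁻¹ * (γ * h)) ≤ σ := by
      rw [← dG_mul_left h, mul_one, mul_inv_cancel_left, dG_comm]
      exact hle
    have h2 : h * (h⁻¹ * (γ * h)) * h⁻¹ ∈ W := hUN (mk_mem_prod hh (hball _ h1))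
    refine hne (hWΓ γ hγ ?_)
    convert h2 using 1
    group
  have key : ∃ σ > 0, ∀ g, pt Γ g ∈ (univ : Set (PhaseSpace Γ)) → ∀ γ ∈ Γ, γ ≠ 1 →
      σ < dG (γ * g) g := by
    refine isCompact_univ.induction_on
      (p := fun S => ∃ σ > 0, ∀ g, pt Γ g ∈ S → ∀ γ ∈ Γ, γ ≠ 1 → σ < dG (γ * g) g) ?_ ?_ ?_ ?_
    · exact ⟨1, one_pos, fun g hg => absurd hg (notMem_empty _)⟩
    · rintro S S' hSS' ⟨σ, hσ, h⟩
      exact ⟨σ, hσ, fun g hg => h g (hSS' hg)⟩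
    · rintro S S' ⟨σ, hσ, h⟩ ⟨σ', hσ', h'⟩
      refine ⟨min σ σ', lt_min hσ hσ', fun g hg γ hγ hne => ?_⟩
      rcases hg with hg | hg
      · exact (min_le_left _ _).trans_lt (h g hg γ hγ hne)
      · exact (min_le_right _ _).trans_lt (h' g hg γ hγ hne)
    · intro x _
      obtain ⟨g, rfl⟩ := pt_surjective x
      obtain ⟨U, hU, hgU, σ, hσ, h⟩ := hloc g
      refine ⟨pt Γ '' U, mem_nhdsWithin_of_mem_nhds
        ((isOpen_image_pt hU).mem_nhds (mem_image_of_mem _ hgU)), σ, hσ, ?_⟩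
      rintro k ⟨k', hk', he⟩ γ hγ hne
      obtain ⟨δ, hδ, rfl⟩ := pt_eq_iff.mp he
      have h1 := h k' hk' (δ⁻¹ * γ * δ) (Γ.mul_mem (Γ.mul_mem (Γ.inv_mem hδ) hγ) hδ) (by
        intro h2
        apply hne
        have : γ = δ * (δ⁻¹ * γ * δ) * δ⁻¹ := by group
        rw [this, h2]; group)
      rw [← dG_mul_left δ] at h1
      simpa [mul_assoc] using h1
  obtain ⟨σ, hσ, h⟩ := key
  exact ⟨σ, hσ, fun γ hγ hne g => h g (mem_univ _) γ hγ hne⟩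

/-! ### Shadowing periodic orbits coincide -/

/-- Two elements of `Γ` which move one point to nearby points are equal. -/
theorem IsDisplacementConst.eq_of_dG_le {Γ : Subgroup PSL2R} {σ : ℝ} (hσ : IsDisplacementConst Γ σ)
    {γ δ : PSL2R} (hγ : γ ∈ Γ) (hδ : δ ∈ Γ) {g : PSL2R} (h : dG (γ * g) (δ * g) ≤ σ) : γ = δ := by
  by_contra hne
  have h1 := hσ.2 (δ⁻¹ * γ) (Γ.mul_mem (Γ.inv_mem hδ) hγ)
    (fun h2 => hne (inv_mul_eq_one.mp h2).symm) g
  rw [← dG_mul_left δ, ← mul_assoc, mul_inv_cancel_left] at h1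
  exact absurd h (not_le.mpr h1)

/-- An element conjugating `a_T` to `a_T'` lies in the diagonal subgroup, and `T = T'`. -/
theorem eq_of_a_mul_eq {T T' : ℝ} (hT : 0 < T) (hT' : 0 < T') {h : PSL2R}
    (he : a T * h = h * a T') : T = T' ∧ ∃ τ, h = a τ := by
  obtain ⟨H, rfl⟩ := toPSL_surjective h
  rw [a_eq, a_eq, ← toPSL_mul, ← toPSL_mul, toPSL_eq_iff] at he
  have hd : H 0 0 * H 1 1 - H 0 1 * H 1 0 = 1 := by
    rw [← Matrix.det_fin_two]; exact H.2
  obtain ⟨η, hη, hη'⟩ : ∃ η : ℝ, (η = 1 ∨ η = -1) ∧ ∀ i j,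
      ((aM T * H : SL2) : Matrix (Fin 2) (Fin 2) ℝ) i j =
        η * ((H * aM T' : SL2) : Matrix (Fin 2) (Fin 2) ℝ) i j := by
    rcases he with he | he
    · exact ⟨1, Or.inl rfl, fun i j => by rw [he, one_mul]⟩
    · exact ⟨-1, Or.inr rfl, fun i j => by rw [he]; simp⟩
  have h00 := hη' 0 0
  have h01 := hη' 0 1
  have h10 := hη' 1 0
  have h11 := hη' 1 1
  simp [coe_aM, Matrix.mul_apply, Fin.sum_univ_two] at h00 h01 h10 h11
  have e1 := Real.exp_pos (T / 2)
  have e2 := Real.exp_pos (T' / 2)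
  have e3 := Real.exp_pos (-T / 2)
  have e4 := Real.exp_pos (-T' / 2)
  have g1 : 1 < Real.exp (T / 2) := Real.one_lt_exp_iff.mpr (by linarith)
  have g2 : 1 < Real.exp (T' / 2) := Real.one_lt_exp_iff.mpr (by linarith)
  have g3 : Real.exp (-T / 2) < 1 := by rw [Real.exp_lt_one_iff]; linarith
  have g4 : Real.exp (-T' / 2) < 1 := by rw [Real.exp_lt_one_iff]; linarith
  have hηabs : ∀ p q r : ℝ, 0 < p → 0 < r → q ≠ 0 → p * q = η * (q * r) → p = r ∧ η = 1 := by
    intro p q r hp hr hq h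
    have h' : p = η * r := mul_right_cancel₀ hq (by linear_combination h)
    rcases hη with rfl | rfl
    · exact ⟨by simpa using h', rfl⟩
    · exfalso; linarith
  have z01 : H 0 1 = 0 := by
    by_contra hq
    have := (hηabs _ _ _ e1 e4 hq h01).1
    linarith
  have z10 : H 1 0 = 0 := by
    by_contra hq
    have := (hηabs _ _ _ e3 e2 hq h10).1
    linarith
  rw [z01] at hd
  have n00 : H 0 0 ≠ 0 := fun h0 => by rw [h0] at hd; norm_num at hd
  have hTT := (hηabs _ _ _ e1 e2 n00 h00).1
  have hlog : Real.exp (Real.log |H 0 0|) = |H 0 0| := Real.exp_log (abs_pos.mpr n00)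
  have hlog' : Real.exp (-Real.log |H 0 0|) = |H 0 0|⁻¹ := by rw [Real.exp_neg, hlog]
  have hd' : H 1 1 = (H 0 0)⁻¹ := by
    field_simp
    linarith
  refine ⟨by linarith [Real.exp_injective hTT], 2 * Real.log |H 0 0|, ?_⟩
  rw [a_eq, toPSL_eq_iff]
  have c1 : 2 * Real.log |H 0 0| / 2 = Real.log |H 0 0| := by ring
  have c2 : -(2 * Real.log |H 0 0|) / 2 = -Real.log |H 0 0| := by ring
  rcases lt_or_gt_of_ne n00 with hneg | hpos
  · right
    ext i j
    rw [Matrix.SpecialLinearGroup.coe_neg, coe_aM, c1, c2, hlog, hlog', abs_of_neg hneg]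
    fin_cases i <;> fin_cases j <;> simp [z01, z10, hd', inv_neg]
  · left
    ext i j
    rw [coe_aM, c1, c2, hlog, hlog', abs_of_pos hpos]
    fin_cases i <;> fin_cases j <;> simp [z01, z10, hd']

/-- Two orbits which are close on a time interval have representatives that are close on all of it:
the elements of `Γ` matching them cannot jump. -/
theorem exists_uniform_lift {Γ : Subgroup PSL2R} {σ : ℝ} (hσ : IsDisplacementConst Γ σ) {ε : ℝ}
    (hε : 0 < ε) (hεσ : 4 * ε ≤ σ) {g h : PSL2R} {T : ℝ} (hT : 0 ≤ T)
    (hd : ∀ t ∈ Icc 0 T, dX Γ (flow Γ t (pt Γ g)) (flow Γ t (pt Γ h)) < ε) :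
    ∃ γ ∈ Γ, dG g (γ * h) < ε ∧ dG (g * a T) (γ * (h * a T)) < ε := by
  have hex : ∀ t, ∃ γ ∈ Γ, t ∈ Icc 0 T → dG (g * a t) (γ * (h * a t)) < ε := fun t => by
    by_cases ht : t ∈ Icc 0 T
    · obtain ⟨γ, hγ, h1⟩ := exists_dG_lt (hd t ht)
      exact ⟨γ, hγ, fun _ => h1⟩
    · exact ⟨1, Γ.one_mem, fun h => absurd h ht⟩
  choose γ hγ hclose using hex
  have hstep : ∀ t t' : ℝ, t ∈ Icc 0 T → t' ∈ Icc 0 T → |t' - t| < ε → γ t = γ t' := by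
    intro t t' ht ht' htt
    have hs : |t' - t| / Real.sqrt 2 ≤ ε := by
      refine (div_le_self (abs_nonneg _) ?_).trans htt.le
      rw [Real.one_le_sqrt]; norm_num
    have e : ∀ k : PSL2R, dG (k * a t) (k * a t') ≤ ε := fun k => by
      have h1 := dG_mul_a_le (k * a t) (t' - t)
      rw [mul_assoc, ← a_add, add_sub_cancel] at h1
      exact h1.trans hs
    refine hσ.eq_of_dG_le (hγ t) (hγ t') (g := h * a t) ?_
    have h1 := hclose t ht
    have h2 := hclose t' ht'
    have h3 := e g
    have h4 := e (γ t' * h)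
    rw [mul_assoc, mul_assoc] at h4
    have t1 := dG_triangle (γ t * (h * a t)) (g * a t) (γ t' * (h * a t))
    have t2 := dG_triangle (g * a t) (g * a t') (γ t' * (h * a t))
    have t3 := dG_triangle (g * a t') (γ t' * (h * a t')) (γ t' * (h * a t))
    rw [dG_comm] at h1 h4
    linarith
  obtain ⟨n, hn⟩ := exists_nat_gt (T / ε)
  have hn0 : 0 < (n : ℝ) := lt_of_le_of_lt (div_nonneg hT hε.le) hn
  have hTn : T / n < ε := by
    rw [div_lt_iff₀ hn0, mul_comm]
    rwa [div_lt_iff₀ hε] at hn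
  have hconst : ∀ k : ℕ, k ≤ n → γ (k * (T / n)) = γ 0 := by
    intro k
    induction k with
    | zero => intro _; simp
    | succ k ih =>
      intro hk
      rw [← ih (by omega)]
      have hmem : ∀ j : ℕ, j ≤ n → (j : ℝ) * (T / n) ∈ Icc 0 T := fun j hj => by
        refine ⟨by positivity, ?_⟩
        have : (j : ℝ) ≤ n := by exact_mod_cast hj
        calc (j : ℝ) * (T / n) ≤ n * (T / n) := by gcongr
          _ = T := by field_simp
      refine (hstep _ _ (hmem k (by omega)) (hmem (k + 1) hk) ?_).symm
      push_cast
      rw [show ((k : ℝ) + 1) * (T / n) - k * (T / n) = T / n by ring, abs_of_nonneg (by positivity)]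
      exact hTn
  have hT' := hconst n le_rfl
  rw [show (n : ℝ) * (T / n) = T by field_simp] at hT'
  have h0 := hclose 0 ⟨le_rfl, hT⟩
  rw [a_zero, mul_one, mul_one] at h0
  refine ⟨γ 0, hγ 0, h0, ?_⟩
  rw [← hT']
  exact hclose T ⟨hT, le_rfl⟩

theorem orbit_flow (Γ : Subgroup PSL2R) (t : ℝ) (x : PhaseSpace Γ) :
    orbit Γ (flow Γ t x) = orbit Γ x := by
  refine Subset.antisymm ?_ ?_
  · rintro _ ⟨s, rfl⟩
    exact ⟨t + s, flow_add t s x⟩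
  · rintro _ ⟨s, rfl⟩
    refine ⟨-t + s, ?_⟩
    simp only [← flow_add]
    congr 1
    ring

/-- Uniform lifts of the two orbits are translated over one period by the same `γ ∈ Γ`, by the
displacement bound. Hence `a_T` and `a_T'` are conjugate, by a diagonal element, which is the time
shift between the orbits. -/
theorem coincidence_of_le {Γ : Subgroup PSL2R} {σ : ℝ} (hσ : IsDisplacementConst Γ σ) {ε : ℝ}
    (hε : 0 < ε) (hεσ : 4 * ε ≤ σ) {x y : PhaseSpace Γ} {T T' : ℝ} (hT : 0 < T) (hTT' : T ≤ T')
    (hx : flow Γ T x = x) (hy : flow Γ T' y = y) (hclose : T' - T ≤ Real.sqrt 2 * ε)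
    (hd : ∀ t ∈ Icc 0 T, dX Γ (flow Γ t x) (flow Γ t y) < ε) :
    T = T' ∧ orbit Γ x = orbit Γ y := by
  obtain ⟨g, rfl⟩ := pt_surjective x
  obtain ⟨h', rfl⟩ := pt_surjective y
  obtain ⟨γ, hγ, h0, h1⟩ := exists_uniform_lift hσ hε hεσ hT.le hd
  obtain ⟨h, rfl⟩ : ∃ h, h' = γ⁻¹ * h := ⟨γ * h', by group⟩
  rw [mul_inv_cancel_left] at h0
  rw [mul_assoc, mul_inv_cancel_left] at h1
  rw [pt_mul_left (Γ.inv_mem hγ)] at hy ⊢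
  obtain ⟨α, hα, hα' : g * a T = α * g⟩ := pt_eq_iff.mp hx.symm
  obtain ⟨β, hβ, hβ' : h * a T' = β * h⟩ := pt_eq_iff.mp hy.symm
  have hαβ : α = β := by
    refine hσ.eq_of_dG_le hα hβ (g := g) ?_
    have t1 := dG_mul_a_le (h * a T) (T' - T)
    rw [mul_assoc, ← a_add, add_sub_cancel, hβ', abs_of_nonneg (by linarith)] at t1
    have t2 : (T' - T) / Real.sqrt 2 ≤ ε := by
      rw [div_le_iff₀ (by positivity), mul_comm]; exact hclose
    have t3 := dG_triangle (α * g) (h * a T) (β * g)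
    have t4 := dG_triangle (h * a T) (β * h) (β * g)
    rw [dG_mul_left, dG_comm h g] at t4
    rw [hα'] at h1
    linarith
  subst hαβ
  have hconj : a T * (g⁻¹ * h) = (g⁻¹ * h) * a T' := by
    have e1 : a T = g⁻¹ * (α * g) := by rw [← hα']; group
    have e2 : a T' = h⁻¹ * (α * h) := by rw [← hβ']; group
    rw [e1, e2]; group
  obtain ⟨hTT, τ, hτ⟩ := eq_of_a_mul_eq hT (hT.trans_le hTT') hconj
  refine ⟨hTT, ?_⟩
  have : pt Γ h = flow Γ τ (pt Γ g) := by
    rw [flow_eq, rightTranslate_pt, ← hτ, mul_inv_cancel_left]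
  rw [this, orbit_flow]

theorem IsDisplacementConst.isCoincidenceConst {Γ : Subgroup PSL2R} {σ : ℝ}
    (hσ : IsDisplacementConst Γ σ) : IsCoincidenceConst Γ (σ / 4) := by
  refine ⟨by linarith [hσ.1], fun ε hε hεσ x y T T' hT hT' hx hy hTT hd => ?_⟩
  have h4 : 4 * ε ≤ σ := by linarith
  rcases le_total T T' with hle | hle
  · rw [min_eq_left hle] at hd
    exact coincidence_of_le hσ hε h4 hT hle hx hy
      (by rw [abs_sub_comm] at hTT; exact (le_abs_self _).trans hTT) hd
  · rw [min_eq_right hle] at hd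
    obtain ⟨h1, h2⟩ := coincidence_of_le hσ hε h4 hT' hle hy hx ((le_abs_self _).trans hTT)
      fun t ht => by rw [dX_comm]; exact hd t ht
    exact ⟨h1.symm, h2.symm⟩

/-! ### Expanding and contracting directions of the reconnected product -/

/-- The action of the connection matrix `c_u b_s` on the slopes `m` of vectors `(1, m)`. -/
noncomputable def mobF (u s m : ℝ) : ℝ := u + m / (1 + s * m)

/-- The action of the inverse connection matrix `(c_u b_s)⁻¹` on the slopes `m` of vectors
`(1, m)`. -/
noncomputable def mobB (u s m : ℝ) : ℝ := (m - u) / (1 + u * s - s * m)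

/-- `f` is continuous on `[-p, p]` and maps it to `[-q, q]`. -/
def MapsBall (f : ℝ → ℝ) (p q : ℝ) : Prop :=
  ContinuousOn f (Icc (-p) p) ∧ MapsTo f (Icc (-p) p) (Icc (-q) q)

theorem MapsBall.comp {f g : ℝ → ℝ} {p q r : ℝ} (hg : MapsBall g q r) (hf : MapsBall f p q) :
    MapsBall (fun m => g (f m)) p r :=
  ⟨hg.1.comp hf.1 hf.2, hg.2.comp hf.2⟩

theorem MapsBall.abs_apply_le {f : ℝ → ℝ} {p q m : ℝ} (hf : MapsBall f p q) (hm : |m| ≤ p) :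
    |f m| ≤ q := abs_le.mpr (hf.2 (abs_le.mp hm))

theorem mapsBall_mul {E p q : ℝ} (hE : 0 ≤ E) (hpq : E * p ≤ q) :
    MapsBall (fun m => E * m) p q := by
  refine ⟨by fun_prop, fun m hm => ?_⟩
  have h1 := mul_le_mul_of_nonneg_left hm.1 hE
  have h2 := mul_le_mul_of_nonneg_left hm.2 hE
  exact ⟨by linarith, by linarith⟩

theorem abs_mul_le_of_le {s m ε k : ℝ} (hs : |s| ≤ ε) (hm : |m| ≤ k * ε) (hε : 72 * ε ^ 2 < 1)
    (hk : 0 ≤ k) : |s * m| ≤ k / 72 := by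
  rw [abs_mul]
  have h0 := (abs_nonneg s).trans hs
  calc |s| * |m| ≤ ε * (k * ε) := mul_le_mul hs hm (abs_nonneg _) h0
    _ ≤ k / 72 := by nlinarith

theorem mapsBall_mobF {u s ε k l : ℝ} (hu : |u| ≤ ε) (hs : |s| ≤ ε) (hε : 72 * ε ^ 2 < 1)
    (hk : 0 ≤ k) (hk' : k < 72) (hl : k ≤ (l - 1) * (1 - k / 72)) :
    MapsBall (mobF u s) (k * ε) (l * ε) := by
  have h0 := (abs_nonneg s).trans hs
  have hden : ∀ m ∈ Icc (-(k * ε)) (k * ε), 1 - k / 72 ≤ 1 + s * m := fun m hm => by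
    have := (abs_le.mp (abs_mul_le_of_le hs (abs_le.mpr hm) hε hk)).1
    linarith
  have hpos : 0 < 1 - k / 72 := by linarith
  refine ⟨?_, fun m hm => ?_⟩
  · unfold mobF
    refine ContinuousOn.add continuousOn_const (continuousOn_id.div (by fun_prop) fun m hm => ?_)
    exact (hpos.trans_le (hden m hm)).ne'
  · have hd := hden m hm
    have hl1 : 0 ≤ l - 1 := by
      by_contra! h
      nlinarith
    have h1 : |m / (1 + s * m)| ≤ (l - 1) * ε := by
      rw [abs_div, abs_of_pos (hpos.trans_le hd), div_le_iff₀ (hpos.trans_le hd)]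
      calc |m| ≤ k * ε := abs_le.mpr hm
        _ ≤ ((l - 1) * (1 - k / 72)) * ε := by gcongr
        _ = (l - 1) * ε * (1 - k / 72) := by ring
        _ ≤ _ := by gcongr
    refine abs_le.mp ((abs_add_le _ _).trans ?_)
    linarith

theorem mobB_den {u s ε k m : ℝ} (hu : |u| ≤ ε) (hs : |s| ≤ ε) (hε : 72 * ε ^ 2 < 1)
    (hk : 0 ≤ k) (hm : |m| ≤ k * ε) : 1 - (1 + k) / 72 ≤ 1 + u * s - s * m := by
  have h1 := (abs_le.mp (abs_mul_le_of_le hs hm hε hk)).2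
  have h2 := (abs_le.mp (abs_mul_le_of_le (k := 1) hu (by simpa using hs) hε zero_le_one)).1
  linarith

theorem mapsBall_mobB {u s ε k l : ℝ} (hu : |u| ≤ ε) (hs : |s| ≤ ε) (hε : 72 * ε ^ 2 < 1)
    (hk : 0 ≤ k) (hk' : k < 71) (hl : k + 1 ≤ l * (1 - (1 + k) / 72)) :
    MapsBall (mobB u s) (k * ε) (l * ε) := by
  have h0 := (abs_nonneg s).trans hs
  have hden : ∀ m ∈ Icc (-(k * ε)) (k * ε), 1 - (1 + k) / 72 ≤ 1 + u * s - s * m := fun m hm =>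
    mobB_den hu hs hε hk (abs_le.mpr hm)
  have hpos : 0 < 1 - (1 + k) / 72 := by linarith
  refine ⟨?_, fun m hm => ?_⟩
  · unfold mobB
    exact ContinuousOn.div (by fun_prop) (by fun_prop) fun m hm => (hpos.trans_le (hden m hm)).ne'
  · have hd := hden m hm
    have hl1 : 0 ≤ l := by
      by_contra! h
      nlinarith
    refine abs_le.mp ?_
    rw [mobB, abs_div, abs_of_pos (hpos.trans_le hd), div_le_iff₀ (hpos.trans_le hd)]
    calc |m - u| ≤ |m| + |u| := abs_sub _ _
      _ ≤ k * ε + ε := add_le_add (abs_le.mpr hm) hu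
      _ = (k + 1) * ε := by ring
      _ ≤ (l * (1 - (1 + k) / 72)) * ε := by gcongr
      _ = l * ε * (1 - (1 + k) / 72) := by ring
      _ ≤ _ := by gcongr

theorem MapsBall.exists_fixed {f : ℝ → ℝ} {p : ℝ} (hp : 0 ≤ p) (hf : MapsBall f p p) :
    ∃ m, |m| ≤ p ∧ f m = m := by
  obtain ⟨m, hm, hfix⟩ := exists_mem_Icc_isFixedPt_of_mapsTo hf.1 (neg_le_self hp) hf.2
  exact ⟨m, abs_le.mpr hm, hfix⟩

/-- The slope of the expanding direction of the reconnected product, together with its images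
under the successive factors. -/
theorem exists_expanding_slopes {u₁ s₁ u₂ s₂ ε E₁ E₂ E₃ E₄ : ℝ} (hε0 : 0 < ε)
    (hε : 72 * ε ^ 2 < 1) (hu₁ : |u₁| ≤ ε) (hs₁ : |s₁| ≤ ε) (hu₂ : |u₂| ≤ ε) (hs₂ : |s₂| ≤ ε)
    (hE₁ : 0 < E₁) (hE₂ : 0 < E₂) (hE₃ : 0 < E₃) (hE₄ : 0 < E₄) (hE₁' : E₁ ≤ 1 / 5)
    (hE₂' : E₂ ≤ 1) (hE₃' : E₃ ≤ 1 / 2) (hE₄' : E₄ ≤ 1 / 9) :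
    ∃ m₀ n₁ n₂ n₃ n₄ : ℝ, n₁ = mobB u₁ s₁ m₀ ∧ n₂ = mobB u₂ s₂ (E₂ * n₁) ∧
      n₃ = mobF u₁ s₁ (E₃ * n₂) ∧ n₄ = mobF u₂ s₂ (E₄ * n₃) ∧ m₀ = E₁ * n₄ ∧
      |m₀| ≤ 1 / 2 * ε ∧ |n₁| ≤ 1.6 * ε ∧ |n₂| ≤ 2.7 * ε ∧ |n₃| ≤ 2.4 * ε ∧ |n₄| ≤ 1.3 * ε := by
  have h1 : MapsBall (mobB u₁ s₁) (1 / 2 * ε) (1.6 * ε) :=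
    mapsBall_mobB hu₁ hs₁ hε (by norm_num) (by norm_num) (by norm_num)
  have h2 : MapsBall (fun m => E₂ * m) (1.6 * ε) (1.6 * ε) := mapsBall_mul hE₂.le (by nlinarith)
  have h3 : MapsBall (mobB u₂ s₂) (1.6 * ε) (2.7 * ε) :=
    mapsBall_mobB hu₂ hs₂ hε (by norm_num) (by norm_num) (by norm_num)
  have h4 : MapsBall (fun m => E₃ * m) (2.7 * ε) (1.35 * ε) := mapsBall_mul hE₃.le (by nlinarith)
  have h5 : MapsBall (mobF u₁ s₁) (1.35 * ε) (2.4 * ε) :=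
    mapsBall_mobF hu₁ hs₁ hε (by norm_num) (by norm_num) (by norm_num)
  have h6 : MapsBall (fun m => E₄ * m) (2.4 * ε) (0.27 * ε) := mapsBall_mul hE₄.le (by nlinarith)
  have h7 : MapsBall (mobF u₂ s₂) (0.27 * ε) (1.3 * ε) :=
    mapsBall_mobF hu₂ hs₂ hε (by norm_num) (by norm_num) (by norm_num)
  have h8 : MapsBall (fun m => E₁ * m) (1.3 * ε) (1 / 2 * ε) := mapsBall_mul hE₁.le (by nlinarith)
  have g1 := h1
  have g2 := h3.comp (h2.comp g1)
  have g3 := h5.comp (h4.comp g2)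
  have g4 := h7.comp (h6.comp g3)
  obtain ⟨m, hm, hfix⟩ := (h8.comp g4).exists_fixed (by positivity)
  exact ⟨m, _, _, _, _, rfl, rfl, rfl, rfl, hfix.symm, hm, g1.abs_apply_le hm, g2.abs_apply_le hm,
    g3.abs_apply_le hm, g4.abs_apply_le hm⟩

/-- The contracting direction of the reconnected product, spanned by `(r₀, 1)`, together with its
images under the inverses of the successive factors. -/
theorem exists_contracting_ratios {u₁ s₁ u₂ s₂ ε E₁ E₂ E₃ E₄ : ℝ} (hε0 : 0 < ε)
    (hε : 72 * ε ^ 2 < 1) (hu₁ : |u₁| ≤ ε) (hs₁ : |s₁| ≤ ε) (hu₂ : |u₂| ≤ ε) (hs₂ : |s₂| ≤ ε)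
    (hE₁ : 0 < E₁) (hE₂ : 0 < E₂) (hE₃ : 0 < E₃) (hE₄ : 0 < E₄) (hE₁' : E₁ ≤ 1 / 5)
    (hE₂' : E₂ ≤ 1) (hE₃' : E₃ ≤ 1 / 2) (hE₄' : E₄ ≤ 1 / 9) :
    ∃ r₀ r₁ r₂ r₃ : ℝ, r₁ = mobF (-s₂) (-u₂) (E₁ * r₀) ∧ r₂ = mobF (-s₁) (-u₁) (E₄ * r₁) ∧
      r₃ = mobB (-s₂) (-u₂) (E₃ * r₂) ∧ r₀ = mobB (-s₁) (-u₁) (E₂ * r₃) ∧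
      |r₀| ≤ 3 * ε ∧ |r₁| ≤ 1.7 * ε ∧ |r₂| ≤ 1.2 * ε ∧ |r₃| ≤ 1.7 * ε := by
  rw [← abs_neg] at hu₁ hs₁ hu₂ hs₂
  have h1 : MapsBall (fun m => E₁ * m) (3 * ε) (0.6 * ε) := mapsBall_mul hE₁.le (by nlinarith)
  have h2 : MapsBall (mobF (-s₂) (-u₂)) (0.6 * ε) (1.7 * ε) :=
    mapsBall_mobF hs₂ hu₂ hε (by norm_num) (by norm_num) (by norm_num)
  have h3 : MapsBall (fun m => E₄ * m) (1.7 * ε) (0.19 * ε) := mapsBall_mul hE₄.le (by nlinarith)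
  have h4 : MapsBall (mobF (-s₁) (-u₁)) (0.19 * ε) (1.2 * ε) :=
    mapsBall_mobF hs₁ hu₁ hε (by norm_num) (by norm_num) (by norm_num)
  have h5 : MapsBall (fun m => E₃ * m) (1.2 * ε) (0.6 * ε) := mapsBall_mul hE₃.le (by nlinarith)
  have h6 : MapsBall (mobB (-s₂) (-u₂)) (0.6 * ε) (1.7 * ε) :=
    mapsBall_mobB hs₂ hu₂ hε (by norm_num) (by norm_num) (by norm_num)
  have h7 : MapsBall (fun m => E₂ * m) (1.7 * ε) (1.7 * ε) := mapsBall_mul hE₂.le (by nlinarith)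
  have h8 : MapsBall (mobB (-s₁) (-u₁)) (1.7 * ε) (3 * ε) :=
    mapsBall_mobB hs₁ hu₁ hε (by norm_num) (by norm_num) (by norm_num)
  have g1 := h2.comp h1
  have g2 := h4.comp (h3.comp g1)
  have g3 := h6.comp (h5.comp g2)
  obtain ⟨m, hm, hfix⟩ := (h8.comp (h7.comp g3)).exists_fixed (by positivity)
  exact ⟨m, _, _, _, rfl, rfl, rfl, hfix.symm, hm, g1.abs_apply_le hm, g2.abs_apply_le hm,
    g3.abs_apply_le hm⟩

/-! ### Relative positions of two orbits -/

/-- The columns of `R` are `α (1, m)` and a multiple of `(r, 1)`. For the relative position `R` of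
two orbits, `m` is the displacement in the expanding direction, `r` that in the contracting
direction, and `α` records the displacement along the flow. -/
def HasFrame (R : SL2) (α m r : ℝ) : Prop :=
  R 0 0 = α ∧ R 1 0 = α * m ∧ R 0 1 = r * R 1 1

theorem det_eq (R : SL2) : R 0 0 * R 1 1 - R 0 1 * R 1 0 = 1 := by
  rw [← Matrix.det_fin_two]; exact R.2

theorem HasFrame.det {R : SL2} {α m r : ℝ} (h : HasFrame R α m r) :
    α * R 1 1 * (1 - m * r) = 1 := by
  have hd := det_eq R
  rw [h.1, h.2.1, h.2.2] at hd
  linear_combination hd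

/-- The connection matrix `c_u b_s`. -/
noncomputable def conn (u s : ℝ) : SL2 := cM u * bM s

theorem coe_conn (u s : ℝ) :
    (conn u s : Matrix (Fin 2) (Fin 2) ℝ) = !![1, s; u, 1 + u * s] := by
  rw [conn, Matrix.SpecialLinearGroup.coe_mul, coe_cM, coe_bM]
  ext i j
  fin_cases i <;> fin_cases j <;> simp [add_comm]

theorem coe_conn_inv (u s : ℝ) :
    (((conn u s)⁻¹ : SL2) : Matrix (Fin 2) (Fin 2) ℝ) = !![1 + u * s, -s; -u, 1] := by
  rw [Matrix.SpecialLinearGroup.coe_inv, coe_conn, Matrix.adjugate_fin_two_of]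

theorem hasFrame_conn {m r : ℝ} (h : 1 - m * r ≠ 0) :
    HasFrame (conn m (r / (1 - m * r))) 1 m r := by
  have hx := mul_inv_cancel₀ h
  refine ⟨?_, ?_, ?_⟩ <;> rw [coe_conn] <;> simp [div_eq_mul_inv]
  left
  linear_combination hx

/-- Along the flow the expanding displacement grows, the contracting one decays, and the
displacement in time is preserved. -/
theorem HasFrame.conj {R : SL2} {α m r : ℝ} (h : HasFrame R α m r) (t : ℝ) :
    HasFrame (aM (-t) * R * aM t) α (m * Real.exp t) (r * Real.exp (-t)) := by
  obtain ⟨h1, h2, h3⟩ := h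
  have e1 : Real.exp (-t / 2) * Real.exp (t / 2) = 1 := by rw [← Real.exp_add]; ring_nf; simp
  have e2 : Real.exp (t / 2) * Real.exp (t / 2) = Real.exp t := by rw [← Real.exp_add]; ring_nf
  have e3 : Real.exp (-t / 2) * Real.exp (-t / 2) = Real.exp (-t) := by
    rw [← Real.exp_add]; ring_nf
  refine ⟨?_, ?_, ?_⟩ <;>
    simp only [Matrix.SpecialLinearGroup.coe_mul, coe_aM, Matrix.mul_apply, Fin.sum_univ_two,
      Matrix.of_apply, Matrix.cons_val', Matrix.cons_val_zero, Matrix.cons_val_one,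
      Matrix.cons_val_fin_one, neg_neg, h1, h2, h3, zero_mul, mul_zero, add_zero, zero_add]
  · linear_combination α * e1
  · linear_combination α * m * e2
  · linear_combination r * R 1 1 * e3 - r * Real.exp (-t) * R 1 1 * e1

/-- A matrix acts on the columns of a frame by its actions on slopes and on ratios. -/
theorem HasFrame.mul {K R : SL2} {α m r f n ρ : ℝ} (h : HasFrame R α m r)
    (h0 : K 0 0 + K 0 1 * m = f) (h1 : K 1 0 + K 1 1 * m = f * n)
    (h2 : K 0 0 * r + K 0 1 = ρ * (K 1 0 * r + K 1 1)) : HasFrame (K * R) (α * f) n ρ := by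
  obtain ⟨g1, g2, g3⟩ := h
  refine ⟨?_, ?_, ?_⟩ <;>
    simp only [Matrix.SpecialLinearGroup.coe_mul, Matrix.mul_apply, Fin.sum_univ_two, g1, g2, g3]
  · linear_combination α * h0
  · linear_combination α * h1
  · linear_combination R 1 1 * h2

/-- On contracting directions `(r, 1)` the matrix `(c_u b_s)⁻¹` acts by `mobF (-s) (-u)`: exchanging
the two coordinates turns `(c_u b_s)⁻¹` into `c_{-s} b_{-u}`. -/
theorem HasFrame.conn_inv_mul {R : SL2} {α u s m r : ℝ} (h : HasFrame R α (mobF u s m) r)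
    (hm : 1 + s * m ≠ 0) (hr : 1 - u * r ≠ 0) :
    HasFrame ((conn u s)⁻¹ * R) (α * (1 + s * m)⁻¹) m (mobF (-s) (-u) r) := by
  have hr' : 1 + -u * r ≠ 0 := by rwa [neg_mul, ← sub_eq_add_neg]
  have hx := mul_inv_cancel₀ hm
  have hy := mul_inv_cancel₀ hr'
  refine h.mul ?_ ?_ ?_ <;> rw [coe_conn_inv] <;>
    simp only [Matrix.of_apply, Matrix.cons_val', Matrix.cons_val_zero,
      Matrix.cons_val_one, Matrix.cons_val_fin_one, mobF, div_eq_mul_inv]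
  · linear_combination -hx
  · ring
  · linear_combination -r * hy

theorem HasFrame.conn_mul {R : SL2} {α u s m r : ℝ} (h : HasFrame R α (mobB u s m) r)
    (hm : 1 + u * s - s * m ≠ 0) (hr : 1 + u * s + u * r ≠ 0) :
    HasFrame (conn u s * R) (α * (1 + u * s - s * m)⁻¹) m (mobB (-s) (-u) r) := by
  have hr' : 1 + -s * -u - -u * r ≠ 0 := by
    convert hr using 1
    ring
  have hx := mul_inv_cancel₀ hm
  have hy := mul_inv_cancel₀ hr'
  refine h.mul ?_ ?_ ?_ <;> rw [coe_conn] <;>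
    simp only [Matrix.of_apply, Matrix.cons_val', Matrix.cons_val_zero,
      Matrix.cons_val_one, Matrix.cons_val_fin_one, mobB, div_eq_mul_inv]
  · linear_combination -hx
  · linear_combination -u * hx
  · linear_combination -(r + s) * hy

/-- A frame is a point of the Poincaré section moved along the flow for the time `2 log α`. -/
theorem HasFrame.eq_conn_mul {R : SL2} {α m r : ℝ} (h : HasFrame R α m r) (hα : 0 < α) :
    R = conn m (r / (1 - m * r)) * aM (2 * Real.log α) := by
  have hd := h.det
  obtain ⟨h1, h2, h3⟩ := h
  have hmr : 1 - m * r ≠ 0 := fun h0 => by rw [h0] at hd; simp at hd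
  have e1 : Real.exp (2 * Real.log α / 2) = α := by
    rw [mul_div_cancel_left₀ _ (by norm_num), Real.exp_log hα]
  have e2 : Real.exp (-(2 * Real.log α) / 2) = α⁻¹ := by rw [neg_div, Real.exp_neg, e1]
  have h4 : R 1 1 = α⁻¹ / (1 - m * r) := by
    field_simp
    linear_combination hd
  ext i j
  rw [Matrix.SpecialLinearGroup.coe_mul, coe_conn, coe_aM, e1, e2]
  fin_cases i <;> fin_cases j <;> simp [h1, h2, h3, h4]
  · ring
  · ring
  · field_simp
    ring

theorem HasFrame.dG_le {R : SL2} {α m r : ℝ} (h : HasFrame R α m r) (hα : 0 < α) :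
    dG 1 (toPSL R) ≤ |m| + Real.sqrt 2 * |Real.log α| + |r| / (α ^ 2 * |1 - m * r|) := by
  have hd := h.det
  have hmr : 1 - m * r ≠ 0 := fun h0 => by rw [h0] at hd; simp at hd
  have h4 : R 1 1 = α⁻¹ / (1 - m * r) := by
    field_simp
    linear_combination hd
  obtain ⟨h1, h2, h3⟩ := h
  have hpos : 0 < R 0 0 := by rw [h1]; exact hα
  rw [eq_cM_mul_aM_mul_bM R hpos, toPSL_mul, toPSL_mul, ← a_eq, ← b_eq, ← c_eq, h1, h2, h3, h4]
  have t1 := dG_mul_c_le 1 (α * m / α)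
  have t2 := dG_mul_a_le (1 * c (α * m / α)) (2 * Real.log α)
  have t3 := dG_mul_b_le (1 * c (α * m / α) * a (2 * Real.log α)) (r * (α⁻¹ / (1 - m * r)) / α)
  have t4 := dG_triangle 1 (1 * c (α * m / α)) (1 * c (α * m / α) * a (2 * Real.log α))
  have t5 := dG_triangle 1 (1 * c (α * m / α) * a (2 * Real.log α))
    (1 * c (α * m / α) * a (2 * Real.log α) * b (r * (α⁻¹ / (1 - m * r)) / α))
  rw [one_mul] at t1 t2 t3 t4 t5
  have e1 : |α * m / α| = |m| := by rw [mul_div_cancel_left₀ _ hα.ne']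
  have e2 : |2 * Real.log α| / Real.sqrt 2 = Real.sqrt 2 * |Real.log α| := by
    rw [abs_mul, abs_two, div_eq_iff (by positivity)]
    have := Real.mul_self_sqrt (show (0 : ℝ) ≤ 2 by norm_num)
    linear_combination -|Real.log α| * this
  have e3 : |r * (α⁻¹ / (1 - m * r)) / α| = |r| / (α ^ 2 * |1 - m * r|) := by
    rw [abs_div, abs_mul, abs_div, abs_inv, abs_of_pos hα]
    field_simp
  rw [e1] at t1
  rw [e2] at t2
  rw [e3] at t3
  linarith

/-! ### The reconnected periodic orbit -/

section

variable {Γ : Subgroup PSL2R}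

/-- If `p` has position `R` relative to `q`, then after time `t` it is `a_{-t} R a_t`. -/
theorem flow_relative {p q : PhaseSpace Γ} {R : SL2}
    (h : p = rightTranslate Γ (toPSL R) q) (t : ℝ) :
    flow Γ t p = rightTranslate Γ (toPSL (aM (-t) * R * aM t)) (flow Γ t q) := by
  rw [h, flow_eq, flow_eq, ← rightTranslate_mul, ← rightTranslate_mul, toPSL_mul, toPSL_mul,
    ← a_eq, ← a_eq, a_neg]
  congr 1
  group

/-- Change of the reference point along a connection from `q` to `q'`. -/
theorem relative_inv {p q q' : PhaseSpace Γ} {R C : SL2} (h : p = rightTranslate Γ (toPSL R) q)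
    (hC : rightTranslate Γ (toPSL C) q = q') :
    p = rightTranslate Γ (toPSL (C⁻¹ * R)) q' := by
  rw [h, ← hC, ← rightTranslate_mul, ← toPSL_mul, mul_inv_cancel_left]

/-- Change of the reference point along a connection from `q'` to `q`. -/
theorem relative_mul {p q q' : PhaseSpace Γ} {R C : SL2} (h : p = rightTranslate Γ (toPSL R) q)
    (hC : rightTranslate Γ (toPSL C) q' = q) :
    p = rightTranslate Γ (toPSL (C * R)) q' := by
  rw [h, ← hC, ← rightTranslate_mul, ← toPSL_mul]

/-- Shadowing along one stretch: it is enough to control the expanding displacement at the end, the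
contracting one at the start, and the time shift. -/
theorem HasFrame.dX_flow_lt {p q : PhaseSpace Γ} {R : SL2} {α m r ε t : ℝ}
    (h : HasFrame R α m r) (hp : p = rightTranslate Γ (toPSL R) q) (hε0 : 0 < ε)
    (hε : 72 * ε ^ 2 < 1) (hα : 0 < α) (hlog : |Real.log α| ≤ 9 * ε ^ 2) (hm : |m| ≤ 3 * ε)
    (hmt : |m| * Real.exp t ≤ 3 * ε) (hr : |r| ≤ 3 * ε) (ht : 0 ≤ t) :
    dX Γ (flow Γ t p) (flow Γ t q) < 10 * ε := by
  rw [flow_relative hp t]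
  refine (dX_rightTranslate_le _ _).trans_lt (((h.conj t).dG_le hα).trans_lt ?_)
  have e1 : m * Real.exp t * (r * Real.exp (-t)) = m * r := by
    have : Real.exp t * Real.exp (-t) = 1 := by rw [← Real.exp_add]; simp
    linear_combination m * r * this
  have hmr : |m * r| ≤ 1 / 8 := by
    rw [abs_mul]
    have := mul_le_mul hm hr (abs_nonneg r) (by positivity)
    nlinarith
  have h1 : 7 / 8 ≤ |1 - m * r| := by
    have := (abs_le.mp hmr).2
    exact le_trans (by linarith) (le_abs_self _)
  have hα2 : 3 / 4 ≤ α ^ 2 := by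
    have e2 : α ^ 2 = Real.exp (2 * Real.log α) := by
      rw [two_mul, Real.exp_add, Real.exp_log hα, sq]
    have e3 := Real.add_one_le_exp (2 * Real.log α)
    have e4 := (abs_le.mp hlog).1
    rw [e2]
    linarith
  have hε' : ε < 0.12 := by nlinarith
  have h2 : |m * Real.exp t| ≤ 3 * ε := by rw [abs_mul, Real.abs_exp]; exact hmt
  have h3 : Real.sqrt 2 * |Real.log α| ≤ 1.5 * (9 * ε ^ 2) := by
    refine mul_le_mul ?_ hlog (abs_nonneg _) (by norm_num)
    rw [Real.sqrt_le_left (by norm_num)]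
    norm_num
  have h4 : |r * Real.exp (-t)| / (α ^ 2 * |1 - m * r|) ≤ 4.6 * ε := by
    have e5 : 21 / 32 ≤ α ^ 2 * |1 - m * r| := by nlinarith
    rw [div_le_iff₀ (by linarith), abs_mul, Real.abs_exp]
    have e6 : Real.exp (-t) ≤ 1 := Real.exp_le_one_iff.mpr (by linarith)
    have e7 : |r| * Real.exp (-t) ≤ 3 * ε * 1 :=
      mul_le_mul hr e6 (Real.exp_pos _).le (by positivity)
    nlinarith
  rw [e1]
  nlinarith

theorem abs_log_sub_le {P e : ℝ} (hP : 71 / 72 ≤ P) (he : |e| ≤ 1 / 10) :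
    |Real.log (P - e) - Real.log P| ≤ 2.1 * |e| := by
  have h1 := (abs_le.mp he).2
  have hPe : 0 < P - e := by linarith
  have hP0 : 0 < P := by linarith
  rw [← Real.log_div hPe.ne' hP0.ne']
  have hy : 0 < (P - e) / P := div_pos hPe hP0
  have hup := Real.log_le_sub_one_of_pos hy
  have hlo := Real.one_sub_inv_le_log_of_pos hy
  have e1 : (P - e) / P - 1 = -e / P := by field_simp; ring
  have e2 : 1 - ((P - e) / P)⁻¹ = -(e / (P - e)) := by field_simp; ring
  have h2 : |-e / P| ≤ 2.1 * |e| := by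
    rw [abs_div, abs_neg, abs_of_pos hP0, div_le_iff₀ hP0]
    nlinarith [abs_nonneg e]
  have h3 : |e / (P - e)| ≤ 2.1 * |e| := by
    rw [abs_div, abs_of_pos hPe, div_le_iff₀ hPe]
    nlinarith [abs_nonneg e]
  rw [e1] at hup
  rw [e2] at hlo
  exact abs_le.mpr ⟨by linarith [(abs_le.mp h3).2], by linarith [(abs_le.mp h2).2]⟩

/-- The periodic point obtained by closing up the reconnected stretches. It is `v = x · k` with `k`
spanned by the expanding and contracting directions at `x` of the product of all stretches and
connections. Its position relative to the old orbit is followed once around: the frame returns to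
`k` up to a diagonal factor, which is the excess of the new period. Each connection contributes to
this factor the amount by which it stretches the expanding direction, `1 + u s` for those passed
backwards and `1` for those passed forwards, up to `O(ε² e^{-Tᵢ})`. -/
theorem exists_reconnected_point {x y z w : PhaseSpace Γ} {T₁ T₂ T₃ T₄ u₁ s₁ u₂ s₂ ε : ℝ}
    (hε0 : 0 < ε) (hε : 72 * ε ^ 2 < 1) (hT₂ : 0 < T₂)
    (hxy : flow Γ T₁ x = y) (hyz : flow Γ T₂ y = z) (hzw : flow Γ T₃ z = w)
    (hwx : flow Γ T₄ w = x)
    (hz : rightTranslate Γ (toPSL (conn u₁ s₁)) x = z)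
    (hw : rightTranslate Γ (toPSL (conn u₂ s₂)) y = w)
    (hu₁ : |u₁| ≤ ε) (hs₁ : |s₁| ≤ ε) (hu₂ : |u₂| ≤ ε) (hs₂ : |s₂| ≤ ε)
    (hE₁ : Real.exp (-T₁) ≤ 1 / 5) (hE₃ : Real.exp (-T₃) ≤ 1 / 2) (hE₄ : Real.exp (-T₄) ≤ 1 / 9) :
    ∃ (v : PhaseSpace Γ) (T' : ℝ), flow Γ T' v = v ∧
      |T' - (T₁ + T₂ + T₃ + T₄)| ≤ 25 * ε ^ 2 ∧
      |(T' - (T₁ + T₂ + T₃ + T₄)) / 2 - Real.log ((1 + u₁ * s₁) * (1 + u₂ * s₂))| ≤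
        6 * ε ^ 2 * (Real.exp (-T₁) + Real.exp (-T₂) + Real.exp (-T₃) + Real.exp (-T₄)) ∧
      (∀ t ∈ Icc 0 T₁, dX Γ (flow Γ t v) (flow Γ t x) < 10 * ε) ∧
      (∀ t ∈ Icc 0 T₄, dX Γ (flow Γ (T₁ + t) v) (flow Γ t w) < 10 * ε) ∧
      (∀ t ∈ Icc 0 T₃, dX Γ (flow Γ (T₁ + T₄ + t) v) (flow Γ t z) < 10 * ε) ∧
      (∀ t ∈ Icc 0 (T₂ + 25 * ε ^ 2),
        dX Γ (flow Γ (T₁ + T₄ + T₃ + t) v) (flow Γ t y) < 10 * ε) ∧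
      ∃ u s : ℝ, rightTranslate Γ (toPSL (conn u s)) y = flow Γ T₁ v ∧ |u| ≤ 1.3 * ε ∧
        |u - u₂| ≤ 3 * ε * Real.exp (-T₄) ∧ |s| ≤ 4 * ε * Real.exp (-T₁) := by
  have hE₂ : Real.exp (-T₂) ≤ 1 := Real.exp_le_one_iff.mpr (neg_nonpos.mpr hT₂.le)
  obtain ⟨m₀, n₁, n₂, n₃, n₄, hn₁, hn₂, hn₃, hn₄, hm₀, bm₀, bn₁, bn₂, bn₃, bn₄⟩ :=
    exists_expanding_slopes hε0 hε hu₁ hs₁ hu₂ hs₂ (Real.exp_pos (-T₁)) (Real.exp_pos (-T₂))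
      (Real.exp_pos (-T₃)) (Real.exp_pos (-T₄)) hE₁ hE₂ hE₃ hE₄
  obtain ⟨r₀, r₁, r₂, r₃, hr₁, hr₂, hr₃, hr₀, br₀, br₁, br₂, br₃⟩ :=
    exists_contracting_ratios hε0 hε hu₁ hs₁ hu₂ hs₂ (Real.exp_pos (-T₁)) (Real.exp_pos (-T₂))
      (Real.exp_pos (-T₃)) (Real.exp_pos (-T₄)) hE₁ hE₂ hE₃ hE₄
  have pE₁ := Real.exp_pos (-T₁)
  have pE₂ := Real.exp_pos (-T₂)
  have pE₃ := Real.exp_pos (-T₃)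
  have pE₄ := Real.exp_pos (-T₄)
  have hexp : ∀ T n : ℝ, Real.exp (-T) * n * Real.exp T = n := fun T n => by
    have : Real.exp (-T) * Real.exp T = 1 := by rw [← Real.exp_add]; simp
    linear_combination n * this
  have hscale : ∀ {E n k l : ℝ}, 0 < E → E ≤ l → |n| ≤ k * ε → |E * n| ≤ l * (k * ε) := by
    intro E n k l h0 hl hn
    rw [abs_mul, abs_of_pos h0]
    exact mul_le_mul hl hn (abs_nonneg _) (h0.le.trans hl)
  have hprod : ∀ {s m k : ℝ}, |s| ≤ ε → |m| ≤ k * ε → |s * m| ≤ k * ε ^ 2 := by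
    intro s m k hs hm
    rw [abs_mul]
    calc |s| * |m| ≤ ε * (k * ε) := mul_le_mul hs hm (abs_nonneg _) hε0.le
      _ = k * ε ^ 2 := by ring
  -- slopes at the starting points of the stretches
  have bm₁ := hscale pE₂ hE₂ bn₁
  have bm₂ := hscale pE₃ hE₃ bn₂
  have bm₃ := hscale pE₄ hE₄ bn₃
  have bq₀ := hscale pE₁ hE₁ br₀
  have bq₁ := hscale pE₄ hE₄ br₁
  have bq₂ := hscale pE₃ hE₃ br₂
  have bq₃ := hscale pE₂ hE₂ br₃
  -- the factors by which the connections stretch the expanding direction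
  have bus₁ := hprod hu₁ (hs₁.trans_eq (one_mul ε).symm)
  have bus₂ := hprod hu₂ (hs₂.trans_eq (one_mul ε).symm)
  have be₁ := hprod hs₁ bm₀
  have be₂ := hprod hs₂ (show |Real.exp (-T₂) * n₁| ≤ 1.6 * ε by linarith only [bm₁])
  have be₃ := hprod hs₁ (show |Real.exp (-T₃) * n₂| ≤ 1.35 * ε by linarith only [bm₂])
  have be₄ := hprod hs₂ (show |Real.exp (-T₄) * n₃| ≤ 0.27 * ε by linarith only [bm₃, hε0])
  have bd₁ := hprod hu₁ (show |Real.exp (-T₂) * r₃| ≤ 1.7 * ε by linarith only [bq₃])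
  have bd₂ := hprod hu₂ (show |Real.exp (-T₃) * r₂| ≤ 0.6 * ε by linarith only [bq₂])
  have bd₃ := hprod hu₁ (show |Real.exp (-T₄) * r₁| ≤ 0.19 * ε by linarith only [bq₁, hε0])
  have bd₄ := hprod hu₂ (show |Real.exp (-T₁) * r₀| ≤ 0.6 * ε by linarith only [bq₀])
  have bmr := hprod (show |m₀| ≤ ε by linarith only [bm₀, hε0]) br₀
  have bnq := hprod (show |Real.exp (-T₁) * r₀| ≤ ε by linarith only [bq₀, hε0]) bn₄
  have hε2 : ε ^ 2 < 1 / 72 := by linarith only [hε]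
  have aus₁ := abs_le.mp bus₁
  have aus₂ := abs_le.mp bus₂
  have ae₁ := abs_le.mp be₁
  have ae₂ := abs_le.mp be₂
  have ae₃ := abs_le.mp be₃
  have ae₄ := abs_le.mp be₄
  have ad₁ := abs_le.mp bd₁
  have ad₂ := abs_le.mp bd₂
  have ad₃ := abs_le.mp bd₃
  have ad₄ := abs_le.mp bd₄
  have amr := abs_le.mp bmr
  have anq := abs_le.mp bnq
  obtain ⟨f₁, hf₁⟩ : ∃ f, f = 1 + u₁ * s₁ - s₁ * m₀ := ⟨_, rfl⟩
  obtain ⟨f₂, hf₂⟩ : ∃ f, f = 1 + u₂ * s₂ - s₂ * (Real.exp (-T₂) * n₁) := ⟨_, rfl⟩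
  obtain ⟨f₃, hf₃⟩ : ∃ f, f = 1 + s₁ * (Real.exp (-T₃) * n₂) := ⟨_, rfl⟩
  obtain ⟨f₄, hf₄⟩ : ∃ f, f = 1 + s₂ * (Real.exp (-T₄) * n₃) := ⟨_, rfl⟩
  have pf₁ : 0 < f₁ := by linarith only [hf₁, aus₁.1, ae₁.2, hε2]
  have pf₂ : 0 < f₂ := by linarith only [hf₂, aus₂.1, ae₂.2, hε2]
  have pf₃ : 0 < f₃ := by linarith only [hf₃, ae₃.1, hε2]
  have pf₄ : 0 < f₄ := by linarith only [hf₄, ae₄.1, hε2]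
  -- the successive positions relative to the old orbit
  obtain ⟨k, hk⟩ : ∃ k, k = conn m₀ (r₀ / (1 - m₀ * r₀)) := ⟨_, rfl⟩
  obtain ⟨v, P₁⟩ : ∃ v, v = rightTranslate Γ (toPSL k) x := ⟨_, rfl⟩
  have F₁ : HasFrame k 1 m₀ r₀ := by
    rw [hk]; exact hasFrame_conn (by linarith only [amr.2, hε2])
  have F₁' := F₁.conj T₁
  have P₁' := flow_relative P₁ T₁
  rw [hxy] at P₁'
  rw [show m₀ * Real.exp T₁ = n₄ by rw [hm₀, hexp], mul_comm r₀] at F₁'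
  generalize aM (-T₁) * k * aM T₁ = R₁ at F₁' P₁'
  have F₂ := (show HasFrame R₁ 1 (mobF u₂ s₂ (Real.exp (-T₄) * n₃)) (Real.exp (-T₁) * r₀) by
    rw [← hn₄]; exact F₁').conn_inv_mul (hf₄ ▸ pf₄.ne') (by linarith only [ad₄.2, hε2])
  rw [← hr₁, one_mul, ← hf₄] at F₂
  have P₂ := relative_inv P₁' hw
  have F₂' := F₂.conj T₄
  have P₂' := flow_relative P₂ T₄
  rw [hwx, ← flow_add] at P₂'
  rw [mul_comm r₁, show Real.exp (-T₄) * n₃ * Real.exp T₄ = mobF u₁ s₁ (Real.exp (-T₃) * n₂) by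
    rw [hexp, hn₃]] at F₂'
  have F₃ := F₂'.conn_inv_mul (hf₃ ▸ pf₃.ne') (by linarith only [ad₃.2, hε2])
  rw [← hr₂, ← hf₃] at F₃
  have P₃ := relative_inv P₂' hz
  have F₃' := F₃.conj T₃
  have P₃' := flow_relative P₃ T₃
  rw [hzw, ← flow_add] at P₃'
  rw [mul_comm r₂, show Real.exp (-T₃) * n₂ * Real.exp T₃ = mobB u₂ s₂ (Real.exp (-T₂) * n₁) by
    rw [hexp, hn₂]] at F₃'
  have F₄ := F₃'.conn_mul (hf₂ ▸ pf₂.ne') (by linarith only [aus₂.1, ad₂.1, hε2])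
  rw [← hr₃, ← hf₂] at F₄
  have P₄ := relative_mul P₃' hw
  have F₄' := F₄.conj T₂
  have P₄' := flow_relative P₄ T₂
  rw [hyz, ← flow_add] at P₄'
  rw [mul_comm r₃, show Real.exp (-T₂) * n₁ * Real.exp T₂ = mobB u₁ s₁ m₀ by
    rw [hexp, hn₁]] at F₄'
  have F₅ := F₄'.conn_mul (hf₁ ▸ pf₁.ne') (by linarith only [aus₁.1, ad₁.1, hε2])
  rw [← hr₀, ← hf₁] at F₅
  have P₅ := relative_mul P₄' hz
  rw [F₅.eq_conn_mul (by positivity), toPSL_mul, rightTranslate_mul, ← hk, ← P₁, ← a_eq,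
    ← flow_eq] at P₅
  have l₁ := abs_log_sub_le (P := 1 + u₁ * s₁) (e := s₁ * m₀) (by linarith only [aus₁.1, hε2])
    (be₁.trans (by linarith only [hε2]))
  have l₂ := abs_log_sub_le (P := 1 + u₂ * s₂) (e := s₂ * (Real.exp (-T₂) * n₁))
    (by linarith only [aus₂.1, hε2]) (be₂.trans (by linarith only [hε2]))
  have l₃ := abs_log_sub_le (P := 1) (e := -(s₁ * (Real.exp (-T₃) * n₂))) (by norm_num)
    (by rw [abs_neg]; exact be₃.trans (by linarith only [hε2]))
  have l₄ := abs_log_sub_le (P := 1) (e := -(s₂ * (Real.exp (-T₄) * n₃))) (by norm_num)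
    (by rw [abs_neg]; exact be₄.trans (by linarith only [hε2]))
  have l₅ := abs_log_sub_le (P := 1) (e := -(u₁ * s₁)) (by norm_num)
    (by rw [abs_neg]; exact bus₁.trans (by linarith only [hε2]))
  have l₆ := abs_log_sub_le (P := 1) (e := -(u₂ * s₂)) (by norm_num)
    (by rw [abs_neg]; exact bus₂.trans (by linarith only [hε2]))
  rw [← hf₁] at l₁
  rw [← hf₂] at l₂
  rw [sub_neg_eq_add, Real.log_one, sub_zero, abs_neg, ← hf₃] at l₃
  rw [sub_neg_eq_add, Real.log_one, sub_zero, abs_neg, ← hf₄] at l₄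
  rw [sub_neg_eq_add, Real.log_one, sub_zero, abs_neg] at l₅ l₆
  have al₁ := abs_le.mp l₁
  have al₂ := abs_le.mp l₂
  have al₃ := abs_le.mp l₃
  have al₄ := abs_le.mp l₄
  have al₅ := abs_le.mp l₅
  have al₆ := abs_le.mp l₆
  have hlog₂ : Real.log f₄⁻¹ = -Real.log f₄ := Real.log_inv _
  have hlog₃ : Real.log (f₄⁻¹ * f₃⁻¹) = -Real.log f₄ - Real.log f₃ := by
    rw [Real.log_mul (by positivity) (by positivity), Real.log_inv, Real.log_inv]; ring
  have hlog₄ : Real.log (f₄⁻¹ * f₃⁻¹ * f₂⁻¹) = -Real.log f₄ - Real.log f₃ - Real.log f₂ := by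
    rw [Real.log_mul (by positivity) (by positivity), hlog₃, Real.log_inv]; ring
  have hlog₅ : Real.log (f₄⁻¹ * f₃⁻¹ * f₂⁻¹ * f₁⁻¹) =
      -Real.log f₄ - Real.log f₃ - Real.log f₂ - Real.log f₁ := by
    rw [Real.log_mul (by positivity) (by positivity), hlog₄, Real.log_inv]; ring
  rw [hlog₅] at P₅
  refine ⟨v, T₁ + T₂ + T₃ + T₄ +
    2 * (Real.log f₄ + Real.log f₃ + Real.log f₂ + Real.log f₁), ?_, ?_, ?_, ?_, ?_, ?_, ?_, ?_⟩
  · have h1 : T₁ + T₂ + T₃ + T₄ + 2 * (Real.log f₄ + Real.log f₃ + Real.log f₂ + Real.log f₁) =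
        (T₁ + T₄ + T₃ + T₂) +
          2 * (Real.log f₄ + Real.log f₃ + Real.log f₂ + Real.log f₁) := by ring
    rw [h1, flow_add, P₅, ← flow_add]
    convert flow_zero v using 2
    ring
  · rw [add_sub_cancel_left]
    refine abs_le.mpr ⟨?_, ?_⟩
    · linarith only [al₁.1, al₂.1, al₃.1, al₄.1, al₅.1, al₆.1, be₁, be₂, be₃, be₄, bus₁, bus₂,
        sq_nonneg ε]
    · linarith only [al₁.2, al₂.2, al₃.2, al₄.2, al₅.2, al₆.2, be₁, be₂, be₃, be₄, bus₁, bus₂,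
        sq_nonneg ε]
  · rw [add_sub_cancel_left, Real.log_mul (by linarith only [aus₁.1, hε2])
      (by linarith only [aus₂.1, hε2])]
    have c₁ := hprod hs₁ (hscale pE₁ le_rfl bn₄ |>.trans_eq
      (show _ = (1.3 * Real.exp (-T₁)) * ε by ring))
    have c₂ := hprod hs₂ (hscale pE₂ le_rfl bn₁ |>.trans_eq
      (show _ = (1.6 * Real.exp (-T₂)) * ε by ring))
    have c₃ := hprod hs₁ (hscale pE₃ le_rfl bn₂ |>.trans_eq
      (show _ = (2.7 * Real.exp (-T₃)) * ε by ring))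
    have c₄ := hprod hs₂ (hscale pE₄ le_rfl bn₃ |>.trans_eq
      (show _ = (2.4 * Real.exp (-T₄)) * ε by ring))
    rw [← hm₀] at c₁
    have p₁ : 0 < Real.exp (-T₁) * ε ^ 2 := by positivity
    have p₂ : 0 < Real.exp (-T₂) * ε ^ 2 := by positivity
    have p₃ : 0 < Real.exp (-T₃) * ε ^ 2 := by positivity
    have p₄ : 0 < Real.exp (-T₄) * ε ^ 2 := by positivity
    refine abs_le.mpr ⟨?_, ?_⟩
    · linarith only [al₁.1, al₂.1, al₃.1, al₄.1, c₁, c₂, c₃, c₄, p₁, p₂, p₃, p₄]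
    · linarith only [al₁.2, al₂.2, al₃.2, al₄.2, c₁, c₂, c₃, c₄, p₁, p₂, p₃, p₄]
  · intro t ht
    refine F₁.dX_flow_lt P₁ hε0 hε one_pos (by rw [Real.log_one, abs_zero]; positivity)
      (by linarith only [bm₀, hε0]) ?_ br₀ ht.1
    rw [hm₀, abs_mul, abs_of_pos pE₁]
    have h1 : Real.exp t ≤ Real.exp T₁ := Real.exp_le_exp.mpr ht.2
    calc Real.exp (-T₁) * |n₄| * Real.exp t ≤ Real.exp (-T₁) * |n₄| * Real.exp T₁ := by gcongr
      _ = |n₄| := hexp _ _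
      _ ≤ _ := by linarith only [bn₄, hε0]
  · intro t ht
    rw [flow_add]
    refine F₂.dX_flow_lt P₂ hε0 hε (by positivity) ?_ (by linarith only [bm₃, hε0]) ?_
      (by linarith only [br₁, hε0]) ht.1
    · rw [hlog₂]
      refine abs_le.mpr ⟨?_, ?_⟩ <;>
        linarith only [al₄.1, al₄.2, be₄, sq_nonneg ε]
    rw [abs_mul, abs_of_pos pE₄]
    have h1 : Real.exp t ≤ Real.exp T₄ := Real.exp_le_exp.mpr ht.2
    calc Real.exp (-T₄) * |n₃| * Real.exp t ≤ Real.exp (-T₄) * |n₃| * Real.exp T₄ := by gcongr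
      _ = |n₃| := hexp _ _
      _ ≤ _ := by linarith only [bn₃, hε0]
  · intro t ht
    rw [flow_add]
    refine F₃.dX_flow_lt P₃ hε0 hε (by positivity) ?_ (by linarith only [bm₂, hε0]) ?_
      (by linarith only [br₂, hε0]) ht.1
    · rw [hlog₃]
      refine abs_le.mpr ⟨?_, ?_⟩ <;>
        linarith only [al₄.1, al₄.2, al₃.1, al₃.2, be₄, be₃, sq_nonneg ε]
    rw [abs_mul, abs_of_pos pE₃]
    have h1 : Real.exp t ≤ Real.exp T₃ := Real.exp_le_exp.mpr ht.2
    calc Real.exp (-T₃) * |n₂| * Real.exp t ≤ Real.exp (-T₃) * |n₂| * Real.exp T₃ := by gcongr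
      _ = |n₂| := hexp _ _
      _ ≤ _ := by linarith only [bn₂, hε0]
  · intro t ht
    rw [flow_add]
    refine F₄.dX_flow_lt P₄ hε0 hε (by positivity) ?_ (by linarith only [bm₁, hε0]) ?_
      (by linarith only [br₃, hε0]) ht.1
    · rw [hlog₄]
      refine abs_le.mpr ⟨?_, ?_⟩ <;>
        linarith only [al₄.1, al₄.2, al₃.1, al₃.2, al₂.1, al₂.2, be₄, be₃,
          be₂, bus₂, al₆.1, al₆.2, sq_nonneg ε]
    rw [abs_mul, abs_of_pos pE₂]
    -- the flow runs for a time up to `25 ε² < 25 / 72` beyond the stretch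
    have h1 : Real.exp t ≤ Real.exp T₂ * Real.exp (25 / 72) := by
      rw [← Real.exp_add]
      exact Real.exp_le_exp.mpr (by linarith only [ht.2, hε2])
    have h2 : Real.exp (25 / 72) ≤ 1.6 := by
      have h3 := Real.one_sub_le_exp_neg (25 / 72)
      have h4 : Real.exp (25 / 72) * Real.exp (-(25 / 72)) = 1 := by rw [← Real.exp_add]; simp
      nlinarith only [Real.exp_pos (25 / 72), h3, h4]
    calc Real.exp (-T₂) * |n₁| * Real.exp t
        ≤ Real.exp (-T₂) * |n₁| * (Real.exp T₂ * Real.exp (25 / 72)) := by gcongr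
      _ = Real.exp (-T₂) * |n₁| * Real.exp T₂ * Real.exp (25 / 72) := by ring
      _ = |n₁| * Real.exp (25 / 72) := by rw [hexp]
      _ ≤ (1.6 * ε) * 1.6 := by gcongr
      _ ≤ _ := by linarith only [hε0]
  · refine ⟨n₄, Real.exp (-T₁) * r₀ / (1 - n₄ * (Real.exp (-T₁) * r₀)), ?_, bn₄, ?_, ?_⟩
    · have h1 := F₁'.eq_conn_mul one_pos
      have h2 : aM 0 = 1 := by
        ext i j
        fin_cases i <;> fin_cases j <;> simp [coe_aM]
      rw [Real.log_one, mul_zero, h2, mul_one] at h1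
      rw [← h1, P₁']
    · rw [hn₄, mobF, add_sub_cancel_left, ← hf₄, abs_div, abs_of_pos pf₄, div_le_iff₀ pf₄]
      have h1 := hscale pE₄ le_rfl bn₃
      have h2 : 0 < ε * Real.exp (-T₄) := by positivity
      have h3 : 0.9 ≤ f₄ := by linarith only [hf₄, ae₄.1, hε2]
      nlinarith only [h1, h2, h3]
    · have h3 : 0.9 ≤ 1 - n₄ * (Real.exp (-T₁) * r₀) := by
        rw [mul_comm n₄]; linarith only [anq.2, hε2]
      rw [abs_div, abs_of_pos (show 0 < 1 - n₄ * (Real.exp (-T₁) * r₀) by linarith only [h3]),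
        div_le_iff₀ (by linarith only [h3])]
      have h1 := hscale pE₁ le_rfl br₀
      have h2 : 0 < ε * Real.exp (-T₁) := by positivity
      nlinarith only [h1, h2, h3]

/-! ### Partner orbits -/

theorem hasCoords_iff {x z : PhaseSpace Γ} {u s : ℝ} :
    HasCoords Γ x z u s ↔ rightTranslate Γ (toPSL (conn u s)) x = z := by
  constructor
  · rintro ⟨g, rfl, rfl⟩
    rw [rightTranslate_pt, conn, toPSL_mul, ← c_eq, ← b_eq, mul_assoc]
  · intro h
    obtain ⟨g, rfl⟩ := pt_surjective x
    refine ⟨g, rfl, ?_⟩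
    rw [← h, rightTranslate_pt, conn, toPSL_mul, ← c_eq, ← b_eq, mul_assoc]

/-- Small Poincaré coordinates are unique. -/
theorem IsDisplacementConst.coords_unique {σ : ℝ} (hσ : IsDisplacementConst Γ σ)
    {y p : PhaseSpace Γ} {u s u' s' : ℝ} (h : HasCoords Γ y p u s) (h' : HasCoords Γ y p u' s')
    (hsmall : |u| + |s| + (|u'| + |s'|) ≤ σ) : u = u' ∧ s = s' := by
  obtain ⟨g, rfl⟩ := pt_surjective y
  rw [hasCoords_iff, rightTranslate_pt] at h h'
  obtain ⟨γ, hγ, he⟩ := pt_eq_iff.mp (h.trans h'.symm)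
  have hk : ∀ u s : ℝ, g * toPSL (conn u s) = g * c u * b s := fun u s => by
    rw [conn, toPSL_mul, ← c_eq, ← b_eq, mul_assoc]
  have h1 : γ = 1 := by
    refine hσ.eq_of_dG_le hγ Γ.one_mem (g := g * toPSL (conn u s)) ?_
    rw [← he, one_mul, hk, hk]
    have t1 := dG_triangle (g * c u' * b s') g (g * c u * b s)
    have t2 := dG_mul_cb_le g u s
    have t3 := dG_mul_cb_le g u' s'
    rw [dG_comm] at t3
    linarith
  rw [h1, one_mul] at he
  rcases toPSL_eq_iff.mp (mul_left_cancel he) with hc | hc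
  · have e1 := congrArg (fun A : SL2 => A 1 0) hc
    have e2 := congrArg (fun A : SL2 => A 0 1) hc
    simp only [coe_conn] at e1 e2
    exact ⟨by simpa using e1.symm, by simpa using e2.symm⟩
  · have e1 := congrArg (fun A : SL2 => A 0 0) hc
    simp only [Matrix.SpecialLinearGroup.coe_neg, coe_conn] at e1
    norm_num at e1

theorem IsPeriodicOrbit.of_mem {T : ℝ} {O : Set (PhaseSpace Γ)} (h : IsPeriodicOrbit Γ T O)
    {v : PhaseSpace Γ} (hv : v ∈ O) : flow Γ T v = v ∧ O = orbit Γ v := by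
  obtain ⟨-, x, hx, rfl⟩ := h
  obtain ⟨t, rfl⟩ := hv
  simp only
  refine ⟨?_, (orbit_flow Γ t x).symm⟩
  rw [← flow_add, add_comm, flow_add, hx]

/-- An orbit through `v` which follows the stretches of durations `T₁`, `T₄`, `T₃`, `T₂` in this
order, entering the last one at a time `τ`, is a partner of the orbit of `x`. -/
theorem isOrbitPair_of_follows {δ T₁ T₂ T₃ T₄ T' τ : ℝ} {O O' : Set (PhaseSpace Γ)}
    {x y z w v : PhaseSpace Γ} (hx : x ∈ O) (hv : v ∈ O') (hT₁ : 0 < T₁) (hT₂ : 0 < T₂)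
    (hT₃ : 0 < T₃) (hT₄ : 0 < T₄) (hτ : T₁ + T₄ < τ) (hτ' : τ < T') (hxy : flow Γ T₁ x = y)
    (hyz : flow Γ T₂ y = z) (hzw : flow Γ T₃ z = w)
    (h₁ : ∀ t ∈ Icc 0 T₁, dX Γ (flow Γ t v) (flow Γ t x) < δ)
    (h₄ : ∀ t ∈ Icc 0 T₄, dX Γ (flow Γ (T₁ + t) v) (flow Γ t w) < δ)
    (h₃ : ∀ t ∈ Icc 0 T₃, dX Γ (flow Γ (T₁ + T₄ + t) v) (flow Γ t z) < δ)
    (h₂ : ∀ t ∈ Icc 0 T₂, dX Γ (flow Γ (τ + t) v) (flow Γ t y) < δ) :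
    IsOrbitPair Γ δ O (T₁ + T₂ + T₃ + T₄) O' T' := by
  refine ⟨4, by norm_num, ![0, T₁, T₁ + T₂, T₁ + T₂ + T₃, T₁ + T₂ + T₃ + T₄],
    ![0, T₁, T₁ + T₄, τ, T'], ?_, rfl, rfl, ?_, rfl, rfl, Equiv.swap 1 3, x, hx, v, hv, ?_⟩
  · rw [Fin.strictMono_iff_lt_succ]
    intro i
    fin_cases i <;> simp <;> linarith
  · rw [Fin.strictMono_iff_lt_succ]
    intro i
    fin_cases i <;> simp <;> linarith
  · intro j
    left
    fin_cases j
    · change ∀ r ∈ Icc 0 (T₁ - 0), dX Γ (flow Γ (r + 0) x) (flow Γ (r + 0) v) < δ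
      intro r hr
      rw [add_zero, dX_comm]
      exact h₁ r (by rwa [sub_zero] at hr)
    · change ∀ r ∈ Icc 0 (T₁ + T₂ - T₁), dX Γ (flow Γ (r + T₁) x) (flow Γ (r + τ) v) < δ
      intro r hr
      rw [add_sub_cancel_left] at hr
      rw [dX_comm, add_comm r, add_comm r, flow_add T₁ r x, hxy]
      exact h₂ r hr
    · change ∀ r ∈ Icc 0 (T₁ + T₂ + T₃ - (T₁ + T₂)),
        dX Γ (flow Γ (r + (T₁ + T₂)) x) (flow Γ (r + (T₁ + T₄)) v) < δ
      intro r hr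
      rw [add_sub_cancel_left] at hr
      rw [dX_comm, add_comm r, add_comm r, flow_add (T₁ + T₂) r x, flow_add T₁ T₂ x, hxy, hyz]
      exact h₃ r hr
    · change ∀ r ∈ Icc 0 (T₁ + T₂ + T₃ + T₄ - (T₁ + T₂ + T₃)),
        dX Γ (flow Γ (r + (T₁ + T₂ + T₃)) x) (flow Γ (r + T₁) v) < δ
      intro r hr
      rw [add_sub_cancel_left] at hr
      rw [dX_comm, add_comm r, add_comm r, flow_add (T₁ + T₂ + T₃) r x, flow_add (T₁ + T₂) T₃ x,
        flow_add T₁ T₂ x, hxy, hyz, hzw]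
      exact h₄ r hr

/-- Two points following the same sequence of stretches follow each other. -/
theorem FollowsReconnected.dX_lt {δ T₁ T₂ T₃ T₄ T' T'' : ℝ} {x y z w v v' : PhaseSpace Γ}
    (h : (∀ t ∈ Icc 0 T₁, dX Γ (flow Γ t v) (flow Γ t x) < δ) ∧
      (∀ t ∈ Icc 0 T₄, dX Γ (flow Γ (T₁ + t) v) (flow Γ t w) < δ) ∧
      (∀ t ∈ Icc 0 T₃, dX Γ (flow Γ (T₁ + T₄ + t) v) (flow Γ t z) < δ) ∧
      (∀ t ∈ Icc 0 (max T₂ (T' - (T₁ + T₄ + T₃))),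
        dX Γ (flow Γ (T₁ + T₄ + T₃ + t) v) (flow Γ t y) < δ))
    (h' : (∀ t ∈ Icc 0 T₁, dX Γ (flow Γ t v') (flow Γ t x) < δ) ∧
      (∀ t ∈ Icc 0 T₄, dX Γ (flow Γ (T₁ + t) v') (flow Γ t w) < δ) ∧
      (∀ t ∈ Icc 0 T₃, dX Γ (flow Γ (T₁ + T₄ + t) v') (flow Γ t z) < δ) ∧
      (∀ t ∈ Icc 0 (max T₂ (T'' - (T₁ + T₄ + T₃))),
        dX Γ (flow Γ (T₁ + T₄ + T₃ + t) v') (flow Γ t y) < δ)) :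
    ∀ t ∈ Icc 0 (min T' T''), dX Γ (flow Γ t v) (flow Γ t v') < 2 * δ := by
  intro t ht
  have key : ∀ q : PhaseSpace Γ, dX Γ (flow Γ t v) q < δ → dX Γ (flow Γ t v') q < δ →
      dX Γ (flow Γ t v) (flow Γ t v') < 2 * δ := fun q h1 h2 => by
    have h3 := dX_triangle (flow Γ t v) q (flow Γ t v')
    rw [dX_comm] at h2
    linarith
  have ht1 := ht.2.trans (min_le_left _ _)
  have ht2 := ht.2.trans (min_le_right _ _)
  by_cases c1 : t ≤ T₁
  · exact key _ (h.1 t ⟨ht.1, c1⟩) (h'.1 t ⟨ht.1, c1⟩)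
  by_cases c2 : t ≤ T₁ + T₄
  · have m : t - T₁ ∈ Icc 0 T₄ := ⟨by linarith, by linarith⟩
    have a1 := h.2.1 _ m
    have a2 := h'.2.1 _ m
    rw [add_sub_cancel] at a1 a2
    exact key _ a1 a2
  by_cases c3 : t ≤ T₁ + T₄ + T₃
  · have m : t - (T₁ + T₄) ∈ Icc 0 T₃ := ⟨by linarith, by linarith⟩
    have a1 := h.2.2.1 _ m
    have a2 := h'.2.2.1 _ m
    rw [add_sub_cancel] at a1 a2
    exact key _ a1 a2
  · have a1 := h.2.2.2 (t - (T₁ + T₄ + T₃)) ⟨by linarith, le_max_of_le_right (by linarith)⟩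
    have a2 := h'.2.2.2 (t - (T₁ + T₄ + T₃)) ⟨by linarith, le_max_of_le_right (by linarith)⟩
    rw [add_sub_cancel] at a1 a2
    exact key _ a1 a2

theorem hasCoords_self (y : PhaseSpace Γ) : HasCoords Γ y y 0 0 := by
  rw [hasCoords_iff]
  have h : conn 0 0 = 1 := by
    ext i j
    rw [coe_conn]
    fin_cases i <;> fin_cases j <;> simp
  rw [h, toPSL_one, rightTranslate_one]

theorem action_error_le {ε E : ℝ} (hε0 : 0 < ε) (hε : 72 * ε ^ 2 < 1) (hE : E ≤ 4) :
    54 * ε ^ 4 + 25 * ε ^ 2 * E ≤ 13 * ε := by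
  have h1 : 25 * ε ^ 2 * E ≤ 25 * ε ^ 2 * 4 := by gcongr
  have h2 : ε ^ 4 ≤ ε ^ 2 / 72 := by nlinarith [sq_nonneg ε]
  have h3 : ε < 0.118 := by nlinarith
  nlinarith

/-- The reconnected orbit is a partner. Its point in the section at `y` is neither `y` nor `w`
because its Poincaré coordinates are close to `(u₂, 0)`, and small coordinates are unique. -/
theorem exists_partner {σ₀ ε T T₁ T₂ T₃ T₄ u₁ s₁ u₂ s₂ : ℝ} {O : Set (PhaseSpace Γ)}
    {x y z w : PhaseSpace Γ} (hσ₀ : IsDisplacementConst Γ σ₀) (hε0 : 0 < ε) (hεσ : ε < σ₀ / 20)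
    (hε : 72 * ε ^ 2 < 1) (hx : x ∈ O) (hT₁ : 0 < T₁) (hT₂ : 0 < T₂) (hT₃ : 0 < T₃) (hT₄ : 0 < T₄)
    (hT : T₁ + T₂ + T₃ + T₄ = T) (hxy : flow Γ T₁ x = y) (hyz : flow Γ T₂ y = z)
    (hzw : flow Γ T₃ z = w) (hwx : flow Γ T₄ w = x) (hu₁ : |u₁| < ε) (hs₁ : |s₁| < ε)
    (hu₂ : |u₂| < ε) (hs₂ : |s₂| < ε) (hcz : HasCoords Γ x z u₁ s₁) (hcw : HasCoords Γ y w u₂ s₂)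
    (hE₁ : Real.exp (-T₁) ≤ 1 / 5) (hE₃ : Real.exp (-T₃) ≤ 1 / 2) (hE₄ : Real.exp (-T₄) ≤ 1 / 9)
    (hsep_u : 3 * ε * Real.exp (-T₄) < |u₂|) (hsep_s : 4 * ε * Real.exp (-T₁) < |s₂|) :
    ∃ (T' : ℝ) (O' : Set (PhaseSpace Γ)),
      IsPeriodicOrbit Γ T' O' ∧
      IsOrbitPair Γ (19 * ε) O T O' T' ∧
      FollowsReconnected Γ (19 * ε) x y z w T₁ T₂ T₃ T₄ O' T' ∧
      (∃ p ∈ O', p ∈ poincareSection Γ (5 * ε) y ∧ p ≠ y ∧ p ≠ w) ∧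
      |(T' - T) / 2 - Real.log ((1 + u₁ * s₁) * (1 + u₂ * s₂))| ≤
        54 * ε ^ 4 + 25 * ε ^ 2 *
          (Real.exp (-T₁) + Real.exp (-T₂) + Real.exp (-T₃) + Real.exp (-T₄)) := by
  have p₁ := Real.exp_pos (-T₁)
  have p₄ := Real.exp_pos (-T₄)
  have q₄ : 0 < ε * Real.exp (-T₄) := by positivity
  have hε' : ε < 0.118 := by nlinarith
  obtain ⟨v, T', hv, hT', hact, h₁, h₄, h₃, h₂, u, s, hp, hu, huu, hs⟩ :=
    exists_reconnected_point hε0 hε hT₂ hxy hyz hzw hwx (hasCoords_iff.mp hcz)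
      (hasCoords_iff.mp hcw) hu₁.le hs₁.le hu₂.le hs₂.le hE₁ hE₃ hE₄
  rw [hT] at hT' hact
  have hT'l := (abs_le.mp hT').1
  have hT'u := (abs_le.mp hT').2
  have hT₃' : 1 / 2 ≤ T₃ := by
    have := Real.add_one_le_exp (-T₃)
    linarith
  have hvO : v ∈ orbit Γ v := ⟨0, flow_zero v⟩
  have hmono : 10 * ε < 19 * ε := by linarith
  have hpc : HasCoords Γ y (flow Γ T₁ v) u s := hasCoords_iff.mpr hp
  have hs' : |s| ≤ 0.8 * ε := by nlinarith
  refine ⟨T', orbit Γ v, ⟨by nlinarith, v, hv, rfl⟩, ?_, ?_, ?_, ?_⟩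
  · -- if the last stretch is too short to fit before `T'`, it is entered slightly early
    rw [← hT]
    refine isOrbitPair_of_follows (τ := min (T₁ + T₄ + T₃) (T' - ε ^ 2)) hx hvO hT₁ hT₂ hT₃ hT₄
      (lt_min (by linarith) (by linarith))
      ((min_le_right _ _).trans_lt (sub_lt_self _ (by positivity)))
      hxy hyz hzw (fun t ht => (h₁ t ht).trans hmono) (fun t ht => (h₄ t ht).trans hmono)
      (fun t ht => (h₃ t ht).trans hmono) fun t ht => ?_
    set τ := min (T₁ + T₄ + T₃) (T' - ε ^ 2) with hτ
    have hτ1 : τ ≤ T₁ + T₄ + T₃ := min_le_left _ _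
    have hτ2 : T₁ + T₄ + T₃ - 26 * ε ^ 2 ≤ τ :=
      le_min (by linarith [sq_nonneg ε]) (by linarith)
    have e1 := h₂ t ⟨ht.1, ht.2.trans (by linarith [sq_nonneg ε])⟩
    have e2 := dX_flow_le (flow Γ (τ + t) v) (T₁ + T₄ + T₃ - τ)
    rw [← flow_add, show τ + t + (T₁ + T₄ + T₃ - τ) = T₁ + T₄ + T₃ + t by ring, dX_comm,
      abs_of_nonneg (by linarith)] at e2
    have e3 : (T₁ + T₄ + T₃ - τ) / Real.sqrt 2 ≤ T₁ + T₄ + T₃ - τ := by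
      refine div_le_self (by linarith) ?_
      rw [Real.one_le_sqrt]
      norm_num
    have e4 := dX_triangle (flow Γ (τ + t) v) (flow Γ (T₁ + T₄ + T₃ + t) v) (flow Γ t y)
    have e5 : 26 * ε ^ 2 ≤ 4 * ε := by nlinarith
    linarith
  · refine ⟨v, hvO, fun t ht => (h₁ t ht).trans hmono, fun t ht => (h₄ t ht).trans hmono,
      fun t ht => (h₃ t ht).trans hmono, fun t ht => (h₂ t ⟨ht.1, ht.2.trans ?_⟩).trans hmono⟩
    exact max_le (by linarith [sq_nonneg ε]) (by linarith)
  · refine ⟨flow Γ T₁ v, ⟨T₁, rfl⟩, ⟨u, s, by linarith, by linarith, hpc⟩, fun h => ?_,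
      fun h => ?_⟩
    · have hc : HasCoords Γ y (flow Γ T₁ v) 0 0 := by
        rw [h]; exact hasCoords_self y
      have h0 := (hσ₀.coords_unique hpc hc (by rw [abs_zero]; linarith)).1
      rw [h0, zero_sub, abs_neg] at huu
      linarith
    · have h0 := (hσ₀.coords_unique hpc (h ▸ hcw) (by linarith)).2
      rw [h0] at hs
      linarith
  · refine hact.trans ?_
    have hsum : 0 ≤ ε ^ 2 * (Real.exp (-T₁) + Real.exp (-T₂) + Real.exp (-T₃) +
        Real.exp (-T₄)) := by positivity
    have : 0 ≤ ε ^ 4 := by positivity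
    linarith

end

end HadamardGutzwiller

theorem mainTheorem2 (Γ : Subgroup PSL2R) [DiscreteTopology Γ] [CompactSpace (PhaseSpace Γ)] :
    (∃ σ₀ : ℝ, IsDisplacementConst Γ σ₀) ∧
    (∃ εs : ℝ, IsCoincidenceConst Γ εs) ∧
    ∀ (σ₀ : ℝ), IsDisplacementConst Γ σ₀ →
    ∀ (ε : ℝ), 0 < ε → ε < σ₀ / 20 →
    ∀ (T : ℝ) (O : Set (PhaseSpace Γ)), IsPeriodicOrbit Γ T O →
    ∀ (x y z w : PhaseSpace Γ), x ∈ O → y ∈ O → z ∈ O → w ∈ O →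
    ∀ (T₁ T₂ T₃ T₄ : ℝ), 0 < T₁ → 0 < T₂ → 0 < T₃ → 0 < T₄ → T₁ + T₂ + T₃ + T₄ = T →
      flow Γ T₁ x = y → flow Γ T₂ y = z → flow Γ T₃ z = w → flow Γ T₄ w = x →
    ∀ (u₁ s₁ u₂ s₂ : ℝ), |u₁| < ε → |s₁| < ε → |u₂| < ε → |s₂| < ε →
      HasCoords Γ x z u₁ s₁ → HasCoords Γ y w u₂ s₂ →
      9 * ε * Real.exp (-T₄) < |u₂| →
      72 * ε ^ 3 + 5 * ε * Real.exp (-T₁) + 2 * ε * Real.exp (-T₃) < |s₂| →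
      (∃ (T' : ℝ) (O' : Set (PhaseSpace Γ)),
        IsPeriodicOrbit Γ T' O' ∧
        IsOrbitPair Γ (19 * ε) O T O' T' ∧
        FollowsReconnected Γ (19 * ε) x y z w T₁ T₂ T₃ T₄ O' T' ∧
        (∃ p ∈ O', p ∈ poincareSection Γ (5 * ε) y ∧ p ≠ y ∧ p ≠ w) ∧
        |(T' - T) / 2 - Real.log ((1 + u₁ * s₁) * (1 + u₂ * s₂))| ≤
          54 * ε ^ 4 + 25 * ε ^ 2 *
            (Real.exp (-T₁) + Real.exp (-T₂) + Real.exp (-T₃) + Real.exp (-T₄))) ∧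
      (∀ εs : ℝ, IsCoincidenceConst Γ εs → ε < εs / 38 →
        ∀ (T' T'' : ℝ) (O' O'' : Set (PhaseSpace Γ)),
          IsPeriodicOrbit Γ T' O' →
          FollowsReconnected Γ (19 * ε) x y z w T₁ T₂ T₃ T₄ O' T' →
          |(T' - T) / 2 - Real.log ((1 + u₁ * s₁) * (1 + u₂ * s₂))| ≤
            54 * ε ^ 4 + 25 * ε ^ 2 *
              (Real.exp (-T₁) + Real.exp (-T₂) + Real.exp (-T₃) + Real.exp (-T₄)) →
          IsPeriodicOrbit Γ T'' O'' →
          FollowsReconnected Γ (19 * ε) x y z w T₁ T₂ T₃ T₄ O'' T'' →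
          |(T'' - T) / 2 - Real.log ((1 + u₁ * s₁) * (1 + u₂ * s₂))| ≤
            54 * ε ^ 4 + 25 * ε ^ 2 *
              (Real.exp (-T₁) + Real.exp (-T₂) + Real.exp (-T₃) + Real.exp (-T₄)) →
          T' = T'' ∧ O' = O'') := by
  refine ⟨exists_isDisplacementConst Γ, ?_, ?_⟩
  · obtain ⟨σ, hσ⟩ := exists_isDisplacementConst Γ
    exact ⟨σ / 4, hσ.isCoincidenceConst⟩
  intro σ₀ hσ₀ ε hε0 hεσ T O hO x y z w hx hy hz hw T₁ T₂ T₃ T₄ hT₁ hT₂ hT₃ hT₄ hT hxy hyz hzw hwx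
    u₁ s₁ u₂ s₂ hu₁ hs₁ hu₂ hs₂ hcz hcw hsep_u hsep_s
  have p₁ := Real.exp_pos (-T₁)
  have p₂ := Real.exp_pos (-T₂)
  have p₃ := Real.exp_pos (-T₃)
  have p₄ := Real.exp_pos (-T₄)
  have q₁ : 0 < ε * Real.exp (-T₁) := by positivity
  have q₃ : 0 < ε * Real.exp (-T₃) := by positivity
  have q₄ : 0 < ε * Real.exp (-T₄) := by positivity
  have hε3 : 0 < ε ^ 3 := by positivity
  -- the separation hypotheses are only possible for small `ε` and long `T₁`, `T₃`, `T₄`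
  have hε : 72 * ε ^ 2 < 1 := by
    have : 72 * ε ^ 3 < ε := by linarith
    by_contra! h
    nlinarith
  have hε' : ε < 0.118 := by nlinarith
  have hE₁ : Real.exp (-T₁) ≤ 1 / 5 := by
    by_contra! h
    nlinarith
  have hE₃ : Real.exp (-T₃) ≤ 1 / 2 := by
    by_contra! h
    nlinarith
  have hE₄ : Real.exp (-T₄) ≤ 1 / 9 := by
    by_contra! h
    nlinarith
  refine ⟨exists_partner hσ₀ hε0 hεσ hε hx hT₁ hT₂ hT₃ hT₄ hT hxy hyz hzw hwx hu₁ hs₁ hu₂ hs₂ hcz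
    hcw hE₁ hE₃ hE₄ (by linarith) (by linarith), ?_⟩
  · intro εs hεs hεεs T' T'' O' O'' hO' hf' hact' hO'' hf'' hact''
    obtain ⟨v, hv, hf'⟩ := hf'
    obtain ⟨v', hv', hf''⟩ := hf''
    obtain ⟨hper, rfl⟩ := hO'.of_mem hv
    obtain ⟨hper', rfl⟩ := hO''.of_mem hv'
    have hclose := FollowsReconnected.dX_lt hf' hf''
    refine hεs.2 (2 * (19 * ε)) (by linarith) (by linarith) v v' T' T'' hO'.1 hO''.1 hper hper' ?_
      hclose
    have hE₂ : Real.exp (-T₂) ≤ 1 := Real.exp_le_one_iff.mpr (by linarith)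
    have hB : 54 * ε ^ 4 + 25 * ε ^ 2 *
        (Real.exp (-T₁) + Real.exp (-T₂) + Real.exp (-T₃) + Real.exp (-T₄)) ≤ 13 * ε :=
      action_error_le hε0 hε (by linarith)
    have hsq : 1.4 ≤ Real.sqrt 2 := Real.le_sqrt_of_sq_le (by norm_num)
    have e3 : 1.4 * (2 * (19 * ε)) ≤ Real.sqrt 2 * (2 * (19 * ε)) := by gcongr
    have b1 := abs_le.mp (hact'.trans hB)
    have b2 := abs_le.mp (hact''.trans hB)
    refine le_trans (abs_le.mpr ⟨?_, ?_⟩) e3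
    · linarith [b1.1, b2.2]
    · linarith [b1.2, b2.1]
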